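/- Let $p_1,\dots,p_N\ge 0$ with $p_1+\dots+p_N=1$, let $Q(z)=\sum_{j=1}^N p_jz^j$, and for $\eta\in L^1_{\mathrm{loc}}([1,\infty),\mathbb R)$, extended by zero to $\mathbb R$, let $\mathbb Q[\eta]=\sum_{j=1}^N p_j\,\eta^{*j}$, where $\eta^{*j}=\eta*\dots*\eta$ ($j$ factors). Let $$\mathbb P=\Bigl\{\eta\in L^1((1,\infty)) : \eta\ge 0 \text{ a.e.},\ \int_1^\infty\eta(y)\,dy=1\Bigr\}.$$ Let $(T_1\eta)(y)=\eta(y-1)$ for $y\ge2$ and $0$ for $y<2$, and $(S_\tau\eta)(y)=e^\tau\eta(e^\tau y)$ for $y\ge1$ and $0$ for $y<1$. Consider the equation $$\partial_\tau\eta=\partial_y(y\eta)+\beta(\tau)\,T_1\mathbb Q[\eta(\tau)],\qquad y\ge1,\ \tau\ge 0. \tag{1}$$ For $\eta_0\in\mathbb P$, its global solution with initial value $\eta_0$ is the unique $\eta\in C^0([0,\infty),L^1((1,\infty)))$ such that $$\eta(\tau)=S_\tau\eta_0+\int_0^\tau\beta(s)\,S_{\tau-s}T_1\mathbb Q[\eta(s)]\,ds\qquad(\tau\ge0),$$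 where the trace $\beta\in L^1_{\mathrm{loc}}([0,\infty))$ satisfies, for every $\tau_0\ge0$, $\beta(\tau)=e^{\tau-\tau_0}\eta(\tau_0,e^{\tau-\tau_0})$ for a.e. $\tau\in[\tau_0,\tau_0+\log2]$. We call $\eta_0$ a steady state of (1) if this solution satisfies $\eta(\tau)=\eta_0$ for all $\tau\ge0$. If $\eta_0$ agrees a.e. on $[1,2]$ with a continuous function $g$ (as every steady state does), we write $\eta_0(1)$ for $g(1)$. Let $\phi$ be the analytic function on the open unit disk with $\phi'(z)=1/(1-Q(z))$ and $\phi(0)=0$. For $\rho\in\mathbb P$, let $\mathcal N(\rho)$ be the (a.e. unique) function $w\in L^1_{\mathrm{loc}}([1,\infty),\mathbb R)$, extended by zero to $(-\infty,1)$, such that for every $\xi\in\mathbb C$ with $\operatorname{Im}\xi<0$ the function $x\mapsto e^{-i\xi x}w(x)$ is integrable and $$\int_1^\infty e^{-i\xi x}w(x)\,dx=\phi\Bigl(\int_1^\infty e^{-i\xi x}\rho(x)\,dx\Bigr);$$ that is, $\mathcal N=\mathcal F^{-1}\circ\phi\circ\mathcal F$. Let $w^*(y)=1/y$ for $y\ge1$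 and $w^*(y)=0$ for $y<1$. **Proposition.** Let $\eta_0\in\mathbb P$ and $\beta>0$. The following assertions are equivalent: a) $\eta_0$ is a steady state of (1) with $\eta_0(1)=\beta$; b) $\eta_0$ coincides almost everywhere on $(1,\infty)$ with the solution $\eta:[1,\infty)\to\mathbb R$ of $$(y\eta)'(y)+\beta\,(T_1\mathbb Q[\eta])(y)=0\quad(y\ge1),\qquad\eta(1)=\beta,$$ meaning that $y\mapsto y\eta(y)$ is absolutely continuous on bounded intervals and that the equation holds for almost every $y>1$; c) $\mathcal N(\eta_0)=\beta w^*$ almost everywhere. -/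

import Mathlib

open MeasureTheory Set
open scoped Convolution Interval

noncomputable section

namespace Coarsening

/-! ### Function-level operations -/

/-- The polynomial `Q(z) = ∑_{j=1}^N p_j z^j`, evaluated at complex arguments. -/
def Qpoly (N : ℕ) (p : ℕ → ℝ) (z : ℂ) : ℂ :=
  ∑ j ∈ Finset.Icc 1 N, (p j : ℂ) * z ^ j

/-- `convPow f k` is the convolution product of `k + 1` factors `f`, on the whole real line. -/
def convPow (f : ℝ → ℝ) : ℕ → ℝ → ℝ
  | 0 => f
  | k + 1 => f ⋆[ContinuousLinearMap.mul ℝ ℝ, volume] convPow f k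

/-- `ℚ[f] = ∑_{j=1}^N p_j f^{*j}`. -/
def nonlin (N : ℕ) (p : ℕ → ℝ) (f : ℝ → ℝ) (x : ℝ) : ℝ :=
  ∑ j ∈ Finset.Icc 1 N, p j * convPow f (j - 1) x

/-- The shift `(T₁ f)(y) = f (y - 1)` for `y ≥ 2`, and `0` for `y < 2`. -/
def shift (f : ℝ → ℝ) : ℝ → ℝ :=
  (Ici (2 : ℝ)).indicator fun y => f (y - 1)

/-- The rescaling `(S_τ f)(y) = e^τ f (e^τ y)` for `y ≥ 1`, and `0` for `y < 1`. -/
def rescale (τ : ℝ) (f : ℝ → ℝ) : ℝ → ℝ :=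
  (Ici (1 : ℝ)).indicator fun y => Real.exp τ * f (Real.exp τ * y)

theorem integrable_convPow {f : ℝ → ℝ} (hf : Integrable f) (k : ℕ) :
    Integrable (convPow f k) := by
  induction k with
  | zero => exact hf
  | succ k ih => exact hf.integrable_convolution _ ih

theorem integrable_nonlin (N : ℕ) (p : ℕ → ℝ) {f : ℝ → ℝ} (hf : Integrable f) :
    Integrable (nonlin N p f) :=
  integrable_finsetSum _ fun j _ => (integrable_convPow hf (j - 1)).const_mul (p j)

theorem integrable_shift {f : ℝ → ℝ} (hf : Integrable f) : Integrable (shift f) :=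
  (hf.comp_sub_right 1).indicator measurableSet_Ici

theorem integrable_rescale (τ : ℝ) {f : ℝ → ℝ} (hf : Integrable f) :
    Integrable (rescale τ f) :=
  ((hf.comp_mul_left' (Real.exp_pos τ).ne').const_mul (Real.exp τ)).indicator measurableSet_Ici

/-! ### The same operations on `L¹(ℝ)` -/

/-- The Banach space `L¹(ℝ)`. Elements of `L¹((1,∞))` are identified with their extensions by
zero, that is, with the elements of `L¹(ℝ)` satisfying `SupportedFromOne`. -/
abbrev L1 : Type := ℝ →₁[volume] ℝ

/-- Vanishing almost everywhere on `(-∞, 1)`. -/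
def SupportedFromOne (f : L1) : Prop := ∀ᵐ y : ℝ, y < 1 → f y = 0

/-- The set of probability densities on `(1,∞)`. -/
def probDensities : Set L1 :=
  {f | SupportedFromOne f ∧ (∀ᵐ y : ℝ, 0 ≤ f y) ∧ ∫ y in Ioi (1 : ℝ), f y = 1}

/-- `ℚ` as a map of `L¹`. -/
def nonlinL1 (N : ℕ) (p : ℕ → ℝ) (f : L1) : L1 :=
  (integrable_nonlin N p (L1.integrable_coeFn f)).toL1 _

/-- `T₁` as a map of `L¹`. -/
def shiftL1 (f : L1) : L1 :=
  (integrable_shift (L1.integrable_coeFn f)).toL1 _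

/-- `S_τ` as a map of `L¹`. -/
def rescaleL1 (τ : ℝ) (f : L1) : L1 :=
  (integrable_rescale τ (L1.integrable_coeFn f)).toL1 _

/-! ### The evolution equation and its steady states -/

/-- `η ∈ C⁰([0,∞), L¹((1,∞)))` is a global (mild) solution, with initial value `η₀`, of
`∂_τ η = ∂_y (y η) + β(τ) T₁ℚ[η]`: the integral equation
`η(τ) = S_τ η₀ + ∫_0^τ β(s) S_{τ-s} T₁ ℚ[η(s)] ds` (a Bochner integral in `L¹`) holds, where
`β ∈ L¹_loc([0,∞))` is the trace of `η` at `y = 1`, given by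
`β(τ) = e^{τ-τ₀} η(τ₀, e^{τ-τ₀})` for all `τ₀ ≥ 0` and almost all `τ` with
`0 ≤ τ - τ₀ ≤ log 2`. Only the values `η τ` with `τ ≥ 0` matter. -/
def IsGlobalSolution (N : ℕ) (p : ℕ → ℝ) (η₀ : L1) (η : ℝ → L1) : Prop :=
  ContinuousOn η (Ici 0) ∧
  (∀ τ, 0 ≤ τ → SupportedFromOne (η τ)) ∧
  ∃ β : ℝ → ℝ,
    LocallyIntegrableOn β (Ici 0) ∧
    (∀ τ₀, 0 ≤ τ₀ → ∀ᵐ τ : ℝ, τ ∈ Icc τ₀ (τ₀ + Real.log 2) →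
      β τ = Real.exp (τ - τ₀) * η τ₀ (Real.exp (τ - τ₀))) ∧
    ∀ τ, 0 ≤ τ →
      η τ = rescaleL1 τ η₀
        + ∫ s in (0 : ℝ)..τ, β s • rescaleL1 (τ - s) (shiftL1 (nonlinL1 N p (η s)))

/-- `η₀` is a steady state: the (existing and unique) global solution with initial value `η₀`
is constant in time. -/
def IsSteadyState (N : ℕ) (p : ℕ → ℝ) (η₀ : L1) : Prop :=
  (∃ η : ℝ → L1, IsGlobalSolution N p η₀ η) ∧
  ∀ η : ℝ → L1, IsGlobalSolution N p η₀ η → ∀ τ, 0 ≤ τ → η τ = η₀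

/-- `η₀(1) = β` for an integrable function `η₀` that agrees almost everywhere on `[1,2]` with a
continuous function: the value at `1` is that of the continuous representative. -/
def HasValueAtOne (η₀ : L1) (β : ℝ) : Prop :=
  ∃ g : ℝ → ℝ, ContinuousOn g (Icc 1 2) ∧ g 1 = β ∧ ∀ᵐ y : ℝ, y ∈ Icc (1 : ℝ) 2 → η₀ y = g y

/-! ### The steady-state differential equation -/

/-- `η : [1,∞) → ℝ` (values at `y < 1` are irrelevant) solves
`(y η)'(y) + β (T₁ ℚ[η])(y) = 0` for `y ≥ 1`, with `η(1) = β`: the function `y η(y)` is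
absolutely continuous on bounded intervals and the equation holds almost everywhere.
In `ℚ[η]` the function `η` is extended by zero to `(-∞, 1)`. -/
structure SolvesSteadyODE (N : ℕ) (p : ℕ → ℝ) (β : ℝ) (η : ℝ → ℝ) : Prop where
  initial : η 1 = β
  absCont : ∀ R : ℝ, 1 < R → AbsolutelyContinuousOnInterval (fun y => y * η y) 1 R
  ode : ∀ᵐ y : ℝ, 1 < y →
    HasDerivAt (fun z => z * η z) (-(β * shift (nonlin N p ((Ici (1 : ℝ)).indicator η)) y)) y

/-! ### The nonlinear transformation `𝒩 = ℱ⁻¹ ∘ φ ∘ ℱ` -/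

/-- The primitive of `1 / (1 - Q)` in the open unit disk that vanishes at `0`, as the integral
along the segment `[0, z]`. -/
def phi (N : ℕ) (p : ℕ → ℝ) (z : ℂ) : ℂ :=
  ∫ t in (0 : ℝ)..1, z / (1 - Qpoly N p ((t : ℂ) * z))

/-- The Fourier(-Laplace) transform `∫_1^∞ e^{-iξx} f(x) dx`, for `Im ξ ≤ 0`. -/
def fourierLaplace (f : ℝ → ℝ) (ξ : ℂ) : ℂ :=
  ∫ x in Ioi (1 : ℝ), Complex.exp (-(Complex.I * ξ * (x : ℂ))) * (f x : ℂ)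

/-- `w = ℱ⁻¹(φ(ℱ ρ))`: `w` is a locally integrable function on `[1,∞)`, extended by zero, whose
Fourier-Laplace transform is `φ(ρ̂(ξ))` in the open lower half-plane. Such a `w` is unique up to
equality almost everywhere. -/
structure IsTransformOf (N : ℕ) (p : ℕ → ℝ) (ρ w : ℝ → ℝ) : Prop where
  locallyIntegrable : LocallyIntegrableOn w (Ici 1)
  eq_zero : ∀ x < 1, w x = 0
  integrable : ∀ ξ : ℂ, ξ.im < 0 →
    IntegrableOn (fun x : ℝ => Complex.exp (-(Complex.I * ξ * (x : ℂ))) * (w x : ℂ)) (Ioi 1)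
  transform_eq : ∀ ξ : ℂ, ξ.im < 0 → fourierLaplace w ξ = phi N p (fourierLaplace ρ ξ)

open Classical in
/-- The map `𝒩 = ℱ⁻¹ ∘ φ ∘ ℱ` (with value `0` where the inverse transform does not exist, which
does not happen for probability densities on `(1,∞)`). -/
def calN (N : ℕ) (p : ℕ → ℝ) (ρ : ℝ → ℝ) : ℝ → ℝ :=
  if h : ∃ w, IsTransformOf N p ρ w then h.choose else 0

/-- `w*(y) = 1/y` for `y ≥ 1`, and `0` for `y < 1`. -/
def wStar : ℝ → ℝ := (Ici (1 : ℝ)).indicator fun y => 1 / y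

end Coarsening

end

open MeasureTheory Set
open scoped Convolution Interval

noncomputable section

namespace Coarsening

open Filter Topology

/-! All three assertions are equivalent to one identity, `SteadyRelation`: y f(y) = β ∫_y^∞ k for
a.e. y > 1, where k = T₁ℚ[f]. Since f is a density, k has mass Q(1) = 1 and lives on [2,∞), so the
tail of k equals 1 up to y = 2.

Differential equation: the identity is its integrated form, the initial value β being fixed by that
unit tail.

Transform: with F the Laplace transform of f, the tail of k has transform (e^{-s}/s)(1 - Q(F)), and
-F' is the transform of x f(x). The identity thus reads -F'/(1 - Q(F)) = β e^{-s}/s, which is the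
derivative in s of φ(F) = β ŵ*, up to sign. The constant of integration vanishes because both sides
tend to 0 as s → +∞; the way back uses injectivity of the transform (`SteadyRelation.phi_laplace`,
`steadyRelation_of_calN_ae_eq`).

Evolution: the tail at a of S_τ f is the tail of f at e^τ max(a,1). Taking tails in Duhamel's
formula for a constant solution with trace β leaves ∫_m^{e^τ m} f = β ∫_m^{e^τ m} (tail of k)(x)/x
dx, with m = max(a,1), which is the identity integrated (`tail_duhamel`). The trace is constant by
`ae_trace_eq`; other solutions are excluded by Grönwall on successive time intervals of length log 2
(`eq_of_duhamel`). -/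

/-! ### Null sets and supports under `convPow`, `nonlin` and `shift`. -/

theorem convPow_congr {f g : ℝ → ℝ} (h : f =ᵐ[volume] g) (k : ℕ) :
    convPow f k =ᵐ[volume] convPow g k := by
  induction k with
  | zero => exact h
  | succ k ih => exact Filter.EventuallyEq.of_eq (convolution_congr _ h ih)

theorem nonlin_congr (N : ℕ) (p : ℕ → ℝ) {f g : ℝ → ℝ} (h : f =ᵐ[volume] g) :
    nonlin N p f =ᵐ[volume] nonlin N p g := by
  have : ∀ᵐ x : ℝ, ∀ k, convPow f k x = convPow g k x :=
    ae_all_iff.2 fun k => convPow_congr h k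
  filter_upwards [this] with x hx
  simp only [nonlin, hx]

theorem shift_congr {f g : ℝ → ℝ} (h : f =ᵐ[volume] g) : shift f =ᵐ[volume] shift g := by
  have := (measurePreserving_sub_right (volume : Measure ℝ) 1).quasiMeasurePreserving.tendsto_ae.eventually h
  filter_upwards [this] with x hx
  simp only [shift, indicator, hx]

theorem convPow_ae_eq_zero {f : ℝ → ℝ} (hf : ∀ᵐ y : ℝ, y < 1 → f y = 0) (k : ℕ) :
    ∀ᵐ y : ℝ, y < 1 → convPow f k y = 0 := by
  induction k with
  | zero => exact hf
  | succ k ih =>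
    refine .of_forall fun x hx => ?_
    change ∫ t, f t * convPow f k (x - t) = 0
    have := (quasiMeasurePreserving_sub_left_of_right_invariant
      (volume : Measure ℝ) x).tendsto_ae.eventually ih
    rw [integral_eq_zero_of_ae]
    filter_upwards [this, hf] with t h1 h2
    rcases lt_or_ge t 1 with h | h
    · simp [h2 h]
    · simp [h1 (by linarith)]

theorem nonlin_ae_eq_zero (N : ℕ) (p : ℕ → ℝ) {f : ℝ → ℝ} (hf : ∀ᵐ y : ℝ, y < 1 → f y = 0) :
    ∀ᵐ y : ℝ, y < 1 → nonlin N p f y = 0 := by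
  have : ∀ᵐ x : ℝ, ∀ k, x < 1 → convPow f k x = 0 :=
    ae_all_iff.2 fun k => convPow_ae_eq_zero hf k
  filter_upwards [this] with x hx h1
  simp [nonlin, hx _ h1]

/-! ### Exponential weights, convolution and total mass. -/

/-- Multiplication of a real function by the exponential `x ↦ e^{-sx}`. -/
def twist (s : ℂ) (f : ℝ → ℝ) (x : ℝ) : ℂ := Complex.exp (-(s * (x : ℂ))) * (f x : ℂ)

theorem twist_zero (f : ℝ → ℝ) : twist 0 f = fun x => (f x : ℂ) := by
  ext x; simp [twist]

/-- Because e^{-sx} = e^{-st} e^{-s(x-t)}, the weight distributes over the two factors pointwise,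
with no integrability needed. This is what turns `nonlin` into `Qpoly` on the transform side. -/
theorem twist_convolution (s : ℂ) (f g : ℝ → ℝ) :
    twist s (f ⋆[ContinuousLinearMap.mul ℝ ℝ, volume] g) =
      twist s f ⋆[ContinuousLinearMap.mul ℂ ℂ, volume] twist s g := by
  ext x
  change Complex.exp (-(s * (x : ℂ))) * ((∫ t, f t * g (x - t) : ℝ) : ℂ) =
    ∫ t, twist s f t * twist s g (x - t)
  rw [← integral_complex_ofReal, ← integral_const_mul]
  congr 1 with t
  have : Complex.exp (-(s * (x : ℂ))) =
      Complex.exp (-(s * (t : ℂ))) * Complex.exp (-(s * ((x - t : ℝ) : ℂ))) := by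
    rw [← Complex.exp_add]; congr 1; push_cast; ring
  simp only [twist, this]
  push_cast
  ring

theorem twist_convPow {s : ℂ} {f : ℝ → ℝ} (hf : Integrable (twist s f)) (k : ℕ) :
    Integrable (twist s (convPow f k)) ∧
      ∫ x, twist s (convPow f k) x = (∫ x, twist s f x) ^ (k + 1) := by
  induction k with
  | zero => exact ⟨hf, by simp [convPow]⟩
  | succ k ih =>
    simp only [convPow, twist_convolution]
    refine ⟨hf.integrable_convolution _ ih.1, ?_⟩
    rw [integral_convolution _ hf ih.1, ih.2]
    simp [pow_succ']

theorem twist_nonlin (N : ℕ) (p : ℕ → ℝ) {s : ℂ} {f : ℝ → ℝ} (hf : Integrable (twist s f)) :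
    Integrable (twist s (nonlin N p f)) ∧
      ∫ x, twist s (nonlin N p f) x = Qpoly N p (∫ x, twist s f x) := by
  have h : twist s (nonlin N p f) =
      fun x => ∑ j ∈ Finset.Icc 1 N, (p j : ℂ) * twist s (convPow f (j - 1)) x := by
    ext x
    simp only [twist, nonlin, Complex.ofReal_sum, Finset.mul_sum]
    refine Finset.sum_congr rfl fun j _ => ?_
    push_cast
    ring
  have hi : ∀ j ∈ Finset.Icc 1 N,
      Integrable (fun x => (p j : ℂ) * twist s (convPow f (j - 1)) x) :=
    fun j _ => (twist_convPow hf (j - 1)).1.const_mul _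
  rw [h]
  refine ⟨integrable_finsetSum _ hi, ?_⟩
  rw [integral_finsetSum _ hi, Qpoly]
  refine Finset.sum_congr rfl fun j hj => ?_
  rw [integral_const_mul, (twist_convPow hf _).2, Nat.sub_add_cancel (Finset.mem_Icc.1 hj).1]

/-- The cutoff at 2 removes nothing when f vanishes below 1, so `shift` is then a plain translation.
-/
theorem shift_ae_eq {f : ℝ → ℝ} (hf : ∀ᵐ y : ℝ, y < 1 → f y = 0) :
    shift f =ᵐ[volume] fun y => f (y - 1) := by
  have := (measurePreserving_sub_right (volume : Measure ℝ) 1).quasiMeasurePreserving.tendsto_ae.eventually hf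
  filter_upwards [this] with x hx
  by_cases h : 2 ≤ x
  · simp [shift, h]
  · rw [hx (by linarith)]; simp [shift, h]

theorem integral_twist_shift {s : ℂ} {f : ℝ → ℝ} (hf : ∀ᵐ y : ℝ, y < 1 → f y = 0) :
    ∫ x, twist s (shift f) x = Complex.exp (-s) * ∫ x, twist s f x := by
  have : twist s (shift f) =ᵐ[volume] fun x => Complex.exp (-s) * twist s f (x - 1) := by
    filter_upwards [shift_ae_eq hf] with x hx
    simp only [twist, hx, ← mul_assoc, ← Complex.exp_add]
    congr 2
    push_cast
    ring
  rw [integral_congr_ae this, integral_const_mul, integral_sub_right_eq_self (twist s f)]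

/-- The case s = 0 of the transform identities: the mass is Q(1). -/
theorem integral_shift_nonlin (N : ℕ) (p : ℕ → ℝ) (hp : ∑ j ∈ Finset.Icc 1 N, p j = 1)
    {f : ℝ → ℝ} (hi : Integrable f) (hf : ∀ᵐ y : ℝ, y < 1 → f y = 0) (h1 : ∫ y, f y = 1) :
    ∫ y, shift (nonlin N p f) y = 1 := by
  have h := integral_twist_shift (s := 0) (nonlin_ae_eq_zero N p hf)
  rw [(twist_nonlin N p (by rw [twist_zero]; exact hi.ofReal)).2] at h
  simp only [twist_zero, integral_complex_ofReal, h1] at h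
  have h2 : (((∑ j ∈ Finset.Icc 1 N, p j : ℝ)) : ℂ) = 1 := by rw [hp]; simp
  simp only [Qpoly, Complex.ofReal_one, one_pow, mul_one, neg_zero, Complex.exp_zero, one_mul] at h
  push_cast at h2
  rw [h2] at h
  exact_mod_cast h

theorem setIntegral_Ioi_one_eq_integral {E : Type*} [NormedAddCommGroup E] [NormedSpace ℝ E]
    {f : ℝ → E} (hf : ∀ᵐ y : ℝ, y < 1 → f y = 0) : ∫ y in Ioi (1 : ℝ), f y = ∫ y, f y := by
  rw [← integral_Ici_eq_integral_Ioi, ← integral_indicator measurableSet_Ici]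
  refine integral_congr_ae ?_
  filter_upwards [hf] with x hx
  by_cases h : 1 ≤ x
  · simp [h]
  · simp [h, hx (not_le.1 h)]

/-! ### Laplace transforms on the half-line: derivative and decay. -/

/-- The Laplace transform over `(1, ∞)`. -/
def laplace (f : ℝ → ℝ) (s : ℂ) : ℂ := ∫ x in Ioi (1 : ℝ), twist s f x

theorem fourierLaplace_eq_laplace (f : ℝ → ℝ) (ξ : ℂ) :
    fourierLaplace f ξ = laplace f (Complex.I * ξ) := rfl

theorem norm_twist (s : ℂ) (f : ℝ → ℝ) (x : ℝ) :
    ‖twist s f x‖ = Real.exp (-(s.re * x)) * |f x| := by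
  simp [twist, Complex.norm_exp]

theorem twist_add (s t : ℂ) (f : ℝ → ℝ) (x : ℝ) :
    twist (s + t) f x = Complex.exp (-(s * (x : ℂ))) * twist t f x := by
  simp only [twist, ← mul_assoc, ← Complex.exp_add]
  congr 2
  ring

/-- All exponentially damped versions of `f` are integrable on `(1, ∞)`. -/
def LaplaceIntegrable (f : ℝ → ℝ) : Prop :=
  ∀ s : ℂ, 0 < s.re → IntegrableOn (twist s f) (Ioi 1)

theorem twist_id_mul (s : ℂ) (f : ℝ → ℝ) (x : ℝ) :
    twist s (fun x => x * f x) x = (x : ℂ) * twist s f x := by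
  simp only [twist]; push_cast; ring

theorem mul_exp_neg_le {c x : ℝ} (hc : 0 < c) : x * Real.exp (-(c * x)) ≤ 1 / c := by
  have h := Real.add_one_le_exp (c * x)
  rw [Real.exp_neg, ← div_eq_mul_inv, div_le_div_iff₀ (Real.exp_pos _) hc]
  nlinarith

/-- Differentiation under the integral on Re z > a/2, with a = Re s. There e^{-x Re z} ≤ e^{-ax/4}
e^{-ax/4}: one factor absorbs the x produced by differentiating, the other keeps the bound
integrable. Integrability of the weighted x f(x) is a by-product. -/
theorem LaplaceIntegrable.hasDerivAt {f : ℝ → ℝ} (hf : LaplaceIntegrable f) {s : ℂ}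
    (hs : 0 < s.re) :
    IntegrableOn (twist s fun x => x * f x) (Ioi 1) ∧
      HasDerivAt (laplace f) (-laplace (fun x => x * f x) s) s := by
  set a := s.re with ha
  have hU : {z : ℂ | a / 2 < z.re} ∈ 𝓝 s :=
    (isOpen_lt continuous_const Complex.continuous_re).mem_nhds (by simp; linarith)
  have h4 : (0 : ℝ) < ((a / 4 : ℝ) : ℂ).re := by simp; linarith
  have key := hasDerivAt_integral_of_dominated_loc_of_deriv_le
    (μ := volume.restrict (Ioi (1 : ℝ))) (F := fun z x => twist z f x)
    (F' := fun z x => -twist z (fun x => x * f x) x)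
    (bound := fun x => (1 / (a / 4)) * ‖twist ((a / 4 : ℝ) : ℂ) f x‖) (x₀ := s) hU ?_ (hf s hs) ?_ ?_
    (((hf _ h4).norm).const_mul _) ?_
  · simp only [integral_neg] at key
    refine ⟨?_, key.2⟩
    have := key.1.neg
    simp only [Pi.neg_def, neg_neg] at this
    exact this
  · filter_upwards [hU] with z hz
    have hz' : a / 2 < z.re := hz
    exact (hf z (by linarith)).aestronglyMeasurable
  · simp only [twist_id_mul]
    exact ((Complex.continuous_ofReal.aestronglyMeasurable).mul
      (hf s hs).aestronglyMeasurable).neg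
  · filter_upwards [ae_restrict_mem measurableSet_Ioi] with x hx z hz
    replace hx : 1 < x := hx
    replace hz : a / 2 < z.re := hz
    rw [norm_neg, twist_id_mul, norm_mul, norm_twist, norm_twist, Complex.norm_real,
      Complex.ofReal_re, Real.norm_of_nonneg (by linarith), ← mul_assoc, ← mul_assoc]
    refine mul_le_mul_of_nonneg_right ?_ (abs_nonneg _)
    have h1 : Real.exp (-(z.re * x)) ≤ Real.exp (-(a / 4 * x)) * Real.exp (-(a / 4 * x)) := by
      rw [← Real.exp_add]
      refine Real.exp_le_exp.2 ?_
      nlinarith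
    calc x * Real.exp (-(z.re * x))
        ≤ x * (Real.exp (-(a / 4 * x)) * Real.exp (-(a / 4 * x))) := by gcongr
      _ = (x * Real.exp (-(a / 4 * x))) * Real.exp (-(a / 4 * x)) := by ring
      _ ≤ _ := mul_le_mul_of_nonneg_right (mul_exp_neg_le (by linarith)) (Real.exp_pos _).le
  · refine .of_forall fun x z _ => ?_
    have h1 : HasDerivAt (fun z : ℂ => -(z * (x : ℂ))) (-(x : ℂ)) z := by
      simpa using ((hasDerivAt_id z).mul_const (x : ℂ)).fun_neg
    have h2 : -twist z (fun x => x * f x) x =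
        Complex.exp (-(z * (x : ℂ))) * -(x : ℂ) * (f x : ℂ) := by
      rw [twist_id_mul, twist]
      ring
    rw [h2]
    exact h1.cexp.mul_const (f x : ℂ)

/-- On x > 1 and for t ≥ 1, e^{-tx} ≤ e^{-(t-1)} e^{-x}. -/
theorem LaplaceIntegrable.tendsto_zero {f : ℝ → ℝ} (hf : LaplaceIntegrable f) :
    Tendsto (fun t : ℝ => laplace f t) atTop (𝓝 0) := by
  have h1 : IntegrableOn (twist 1 f) (Ioi 1) := hf 1 (by simp)
  refine squeeze_zero_norm' (a := fun t : ℝ => Real.exp (-(t - 1)) * ∫ x in Ioi (1 : ℝ), ‖twist 1 f x‖)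
    ?_ ?_
  · filter_upwards [eventually_ge_atTop 1] with t ht
    rw [laplace, ← integral_const_mul]
    refine norm_integral_le_of_norm_le (h1.norm.const_mul _) ?_
    filter_upwards [ae_restrict_mem measurableSet_Ioi] with x hx
    simp only [mem_Ioi] at hx
    rw [norm_twist, norm_twist, ← mul_assoc, ← Real.exp_add]
    refine mul_le_mul_of_nonneg_right (Real.exp_le_exp.2 ?_) (abs_nonneg _)
    simp only [Complex.ofReal_re, Complex.one_re]
    nlinarith
  · have : Tendsto (fun t : ℝ => Real.exp (-(t - 1))) atTop (𝓝 0) :=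
      Real.tendsto_exp_neg_atTop_nhds_zero.comp (tendsto_atTop_add_const_right _ (-1) tendsto_id)
    simpa using this.mul_const (∫ x in Ioi (1 : ℝ), ‖twist 1 f x‖)

/-! ### Injectivity of the Fourier and Laplace transforms. -/

/-- Injectivity of the Fourier transform on real integrable functions. -/
theorem ae_eq_zero_of_integral_exp_mul_eq_zero {f : ℝ → ℝ} {μ : Measure ℝ} [SFinite μ]
    (hf : Integrable f μ)
    (h : ∀ t : ℝ, ∫ x, Complex.exp (t * x * Complex.I) * (f x : ℂ) ∂μ = 0) :
    f =ᵐ[μ] 0 := by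
  -- `ENNReal.ofReal` truncates at 0, so the densities built from f and -f are the positive and
  -- negative parts of f. The hypothesis says that these two finite measures have the same
  -- characteristic function.
  have hpos : ∀ g : ℝ → ℝ, Integrable g μ → IsFiniteMeasure (μ.withDensity fun x => ENNReal.ofReal (g x)) :=
    fun g hg => isFiniteMeasure_withDensity_ofReal hg.2
  have hn : Integrable (fun x => -f x) μ := hf.neg
  have h1 := hpos f hf
  have h2 := hpos _ hn
  have hint : ∀ g : ℝ → ℝ, Integrable g μ → ∀ t : ℝ,
      charFun (μ.withDensity fun x => ENNReal.ofReal (g x)) t =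
        ∫ x, Complex.exp (t * x * Complex.I) * ((max (g x) 0 : ℝ) : ℂ) ∂μ := by
    intro g hg t
    rw [charFun_apply_real, integral_withDensity_eq_integral_toReal_smul₀
      hg.aemeasurable.ennreal_ofReal (.of_forall fun x => ENNReal.ofReal_lt_top)]
    congr 1 with x
    rw [ENNReal.toReal_ofReal', Complex.real_smul, mul_comm]
  have hi : ∀ g : ℝ → ℝ, Integrable g μ → ∀ t : ℝ,
      Integrable (fun x : ℝ => Complex.exp (t * x * Complex.I) * ((max (g x) 0 : ℝ) : ℂ)) μ := by
    intro g hg t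
    refine Integrable.bdd_mul (c := 1) (hg.pos_part.ofReal (𝕜 := ℂ)) (by fun_prop) (.of_forall fun x => ?_)
    rw [← Complex.ofReal_mul, Complex.norm_exp_ofReal_mul_I]
  have heq : (μ.withDensity fun x => ENNReal.ofReal (f x)) =
      μ.withDensity fun x => ENNReal.ofReal (-f x) := by
    refine Measure.ext_of_charFun (funext fun t => ?_)
    rw [hint f hf, hint _ hn, ← sub_eq_zero, ← integral_sub (hi f hf t) (hi _ hn t), ← h t]
    congr 1 with x
    rw [← mul_sub, ← Complex.ofReal_sub]
    congr 2
    exact posPart_sub_negPart (f x)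
  have hfin : ∫⁻ x, ENNReal.ofReal (f x) ∂μ ≠ ⊤ := hf.lintegral_lt_top.ne
  have := (withDensity_eq_iff hf.aemeasurable.ennreal_ofReal
    hn.aemeasurable.ennreal_ofReal hfin).1 heq
  filter_upwards [this] with x hx
  simp only [Pi.zero_apply] at hx ⊢
  rcases lt_trichotomy (f x) 0 with h | h | h
  · rw [ENNReal.ofReal_of_nonpos h.le] at hx
    have := ENNReal.ofReal_eq_zero.1 hx.symm
    linarith
  · exact h
  · rw [ENNReal.ofReal_of_nonpos (p := -f x) (by linarith)] at hx
    have := ENNReal.ofReal_eq_zero.1 hx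
    linarith

/-- On the line Re s = 1 the Laplace transform is the Fourier transform of e^{-x} f(x); no other s
is needed. -/
theorem ae_eq_zero_of_laplace_eq_zero {f : ℝ → ℝ}
    (hf : IntegrableOn (twist 1 f) (Ioi 1))
    (h : ∀ s : ℂ, 0 < s.re → laplace f s = 0) : ∀ᵐ x : ℝ, 1 < x → f x = 0 := by
  refine (ae_restrict_iff' (p := fun x => f x = 0) (measurableSet_Ioi (a := (1 : ℝ)))).1 ?_
  have hre : ∀ x, twist 1 f x = ((Real.exp (-x) * f x : ℝ) : ℂ) := by
    intro x; simp [twist]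
  have hi : Integrable (fun x => Real.exp (-x) * f x) (volume.restrict (Ioi 1)) := by
    refine hf.re.congr (.of_forall fun x => ?_)
    change (twist 1 f x).re = _
    rw [hre, Complex.ofReal_re]
  have := ae_eq_zero_of_integral_exp_mul_eq_zero hi fun t => ?_
  · filter_upwards [this] with x hx
    simpa [Real.exp_ne_zero] using hx
  · rw [← h (1 - t * Complex.I) (by simp), laplace]
    congr 1 with x
    rw [← hre, sub_eq_neg_add, twist_add]
    congr 2
    ring

/-! ### Tails and their Laplace transforms. -/

/-- The tail `x ↦ ∫_x^∞ h` of an integrable function. -/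
def tail (h : ℝ → ℝ) (x : ℝ) : ℝ := ∫ y in Ioi x, h y

theorem tail_sub_tail {h : ℝ → ℝ} (hh : Integrable h) (a b : ℝ) :
    tail h a - tail h b = ∫ x in a..b, h x :=
  intervalIntegral.integral_Ioi_sub_Ioi' hh.integrableOn hh.integrableOn

theorem continuous_tail {h : ℝ → ℝ} (hh : Integrable h) : Continuous (tail h) := by
  have : tail h = fun x => tail h 0 - ∫ y in (0 : ℝ)..x, h y := by
    ext x; rw [← tail_sub_tail hh]; ring
  rw [this]
  exact continuous_const.sub (hh.continuous_primitive 0)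

theorem abs_tail_le {h : ℝ → ℝ} (hh : Integrable h) (x : ℝ) : |tail h x| ≤ ∫ y, |h y| :=
  (norm_integral_le_integral_norm _).trans
    (setIntegral_le_integral hh.norm (.of_forall fun _ => norm_nonneg _))

theorem laplaceIntegrable_of_bounded {f : ℝ → ℝ} {C : ℝ}
    (hf : AEStronglyMeasurable f (volume.restrict (Ioi 1))) (hC : ∀ x, |f x| ≤ C) :
    LaplaceIntegrable f := fun s hs => by
  have h := integrableOn_exp_mul_complex_Ioi (a := -s) (by simpa using hs) 1
  simp only [neg_mul] at h
  refine Integrable.mul_bdd (c := C) h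
    (Complex.continuous_ofReal.comp_aestronglyMeasurable hf) (.of_forall fun x => by simpa using hC x)

theorem laplaceIntegrable_of_integrable {f : ℝ → ℝ} (hf : Integrable f) :
    LaplaceIntegrable f := fun s hs => by
  refine Integrable.bdd_mul (c := 1) (hf.ofReal.integrableOn) (by fun_prop) ?_
  filter_upwards [ae_restrict_mem measurableSet_Ioi] with x hx
  simp only [mem_Ioi] at hx
  rw [Complex.norm_exp]
  simp
  nlinarith

theorem laplaceIntegrable_tail {h : ℝ → ℝ} (hh : Integrable h) : LaplaceIntegrable (tail h) :=
  laplaceIntegrable_of_bounded (continuous_tail hh).aestronglyMeasurable (abs_tail_le hh)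

/-- Integration by parts in the form of Fubini on {1 < x < y}: the inner integral of e^{-sx} over
(1, y) is s⁻¹(e^{-s} - e^{-sy}). -/
theorem mul_laplace_tail {h : ℝ → ℝ} (hh : Integrable h) {s : ℂ} (hs : 0 < s.re) :
    s * laplace (tail h) s = Complex.exp (-s) * (tail h 1 : ℂ) - laplace h s := by
  have hs0 : s ≠ 0 := by rintro rfl; simp at hs
  have hexp : IntegrableOn (fun x : ℝ => Complex.exp (-(s * (x : ℂ)))) (Ioi 1) := by
    simpa using integrableOn_exp_mul_complex_Ioi (a := -s) (by simpa using hs) 1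
  let F : ℝ → ℝ → ℂ := fun x y =>
    {q : ℝ × ℝ | q.1 < q.2}.indicator
      (fun q => Complex.exp (-(s * (q.1 : ℂ))) * (h q.2 : ℂ)) (x, y)
  have hF : Integrable (Function.uncurry F)
      ((volume.restrict (Ioi (1 : ℝ))).prod (volume.restrict (Ioi (1 : ℝ)))) :=
    (hexp.integrable.mul_prod (hh.ofReal (𝕜 := ℂ)).integrableOn).indicator
      (measurableSet_lt measurable_fst measurable_snd)
  have h1 : ∀ x ∈ Ioi (1 : ℝ), twist s (tail h) x = ∫ y in Ioi (1 : ℝ), F x y := by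
    intro x hx
    have hF' : F x = (Ioi x).indicator fun y => Complex.exp (-(s * (x : ℂ))) * (h y : ℂ) := by
      ext y; simp [F, indicator]
    rw [hF', setIntegral_indicator measurableSet_Ioi,
      inter_eq_self_of_subset_right (Ioi_subset_Ioi (le_of_lt hx)), integral_const_mul,
      integral_complex_ofReal]
    rfl
  have h2 : ∀ y ∈ Ioi (1 : ℝ), ∫ x in Ioi (1 : ℝ), F x y =
      s⁻¹ * (Complex.exp (-s) * (h y : ℂ) - twist s h y) := by
    intro y hy
    have hy' : (1 : ℝ) ≤ y := le_of_lt hy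
    have hF' : (fun x => F x y) =
        (Iio y).indicator fun x => Complex.exp (-(s * (x : ℂ))) * (h y : ℂ) := by
      ext x; simp [F, indicator]
    rw [hF', setIntegral_indicator measurableSet_Iio, Ioi_inter_Iio, ← integral_Ioc_eq_integral_Ioo,
      ← intervalIntegral.integral_of_le hy', intervalIntegral.integral_mul_const]
    have := integral_exp_mul_complex (a := 1) (b := y) (c := -s) (neg_ne_zero.2 hs0)
    simp only [neg_mul] at this
    rw [this, twist]
    simp only [Complex.ofReal_one, mul_one]
    field_simp
    ring
  have hti : IntegrableOn (twist s h) (Ioi 1) := laplaceIntegrable_of_integrable hh s hs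
  rw [laplace, setIntegral_congr_fun measurableSet_Ioi h1, integral_integral_swap hF,
    setIntegral_congr_fun measurableSet_Ioi h2, integral_const_mul,
    mul_inv_cancel_left₀ hs0, integral_sub (f := fun y => Complex.exp (-s) * (h y : ℂ))
      ((hh.ofReal (𝕜 := ℂ)).integrableOn.integrable.const_mul _) hti, integral_const_mul]
  congr 2
  exact integral_complex_ofReal

/-! ### The transform of `wStar`, and `phi` on the unit disk. -/

theorem wStar_of_one_le {x : ℝ} (hx : 1 ≤ x) : wStar x = 1 / x := by simp [wStar, hx]

theorem measurable_wStar : Measurable wStar :=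
  (measurable_const.div measurable_id).indicator measurableSet_Ici

theorem abs_wStar_le (x : ℝ) : |wStar x| ≤ 1 := by
  by_cases h : 1 ≤ x
  · rw [wStar_of_one_le h, abs_of_nonneg (by positivity), div_le_one (by linarith)]
    exact h
  · simp [wStar, h]

theorem laplaceIntegrable_wStar : LaplaceIntegrable wStar :=
  laplaceIntegrable_of_bounded measurable_wStar.aestronglyMeasurable abs_wStar_le

/-- x w*(x) = 1 on the half-line. The same factor e^{-s}/s appears in `IsDensity.laplace_tail`,
which is why `wStar` is the right target. -/
theorem laplace_id_mul_wStar {s : ℂ} (hs : 0 < s.re) :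
    laplace (fun x => x * wStar x) s = Complex.exp (-s) / s := by
  have h := integral_exp_mul_complex_Ioi (a := -s) (by simpa using hs) 1
  rw [laplace]
  have : ∀ x ∈ Ioi (1 : ℝ), twist s (fun x => x * wStar x) x = Complex.exp (-s * x) := by
    intro x hx
    have hx' : (1 : ℝ) < x := hx
    have h0 : x ≠ 0 := by positivity
    rw [twist, wStar_of_one_le hx'.le, mul_one_div_cancel h0]
    simp
  rw [setIntegral_congr_fun measurableSet_Ioi this, h]
  simp

/-- All exponents are at least 1 and the weights sum to 1, so |Q(z)| ≤ |z|. -/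
theorem norm_Qpoly_lt_one {N : ℕ} {p : ℕ → ℝ} (hp0 : ∀ j ∈ Finset.Icc 1 N, 0 ≤ p j)
    (hp1 : ∑ j ∈ Finset.Icc 1 N, p j = 1) {z : ℂ} (hz : ‖z‖ < 1) : ‖Qpoly N p z‖ < 1 := by
  refine lt_of_le_of_lt ?_ hz
  calc ‖Qpoly N p z‖ ≤ ∑ j ∈ Finset.Icc 1 N, p j * ‖z‖ := by
        refine norm_sum_le_of_le _ fun j hj => ?_
        rw [norm_mul, norm_pow, Complex.norm_real, Real.norm_of_nonneg (hp0 j hj)]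
        refine mul_le_mul_of_nonneg_left ?_ (hp0 j hj)
        exact pow_le_of_le_one (norm_nonneg _) hz.le
          (by have := (Finset.mem_Icc.1 hj).1; omega)
    _ = ‖z‖ := by rw [← Finset.sum_mul, hp1, one_mul]

theorem one_sub_Qpoly_ne_zero {N : ℕ} {p : ℕ → ℝ} (hp0 : ∀ j ∈ Finset.Icc 1 N, 0 ≤ p j)
    (hp1 : ∑ j ∈ Finset.Icc 1 N, p j = 1) {z : ℂ} (hz : ‖z‖ < 1) : 1 - Qpoly N p z ≠ 0 := by
  intro h
  have := norm_Qpoly_lt_one hp0 hp1 hz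
  rw [← sub_eq_zero.1 h] at this
  simp at this

theorem differentiable_Qpoly (N : ℕ) (p : ℕ → ℝ) : Differentiable ℂ (Qpoly N p) := by
  unfold Qpoly
  fun_prop

theorem phi_zero (N : ℕ) (p : ℕ → ℝ) : phi N p 0 = 0 := by simp [phi]

/-- The function 1/(1 - Q) is holomorphic on the disk, hence has a primitive g there; the
fundamental theorem of calculus along [0, w] identifies `phi` with g - g(0). -/
theorem hasDerivAt_phi {N : ℕ} {p : ℕ → ℝ} (hp0 : ∀ j ∈ Finset.Icc 1 N, 0 ≤ p j)
    (hp1 : ∑ j ∈ Finset.Icc 1 N, p j = 1) {z : ℂ} (hz : ‖z‖ < 1) :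
    HasDerivAt (phi N p) (1 / (1 - Qpoly N p z)) z := by
  have hd : DifferentiableOn ℂ (fun z => 1 / (1 - Qpoly N p z)) (Metric.ball 0 1) := by
    refine (differentiableOn_const _).div
      ((differentiableOn_const _).sub (differentiable_Qpoly N p).differentiableOn) fun w hw => ?_
    exact one_sub_Qpoly_ne_zero hp0 hp1 (by simpa using hw)
  obtain ⟨g, hg⟩ := hd.isExactOn_ball
  have hphi : ∀ w ∈ Metric.ball (0 : ℂ) 1, phi N p w = g w - g 0 := by
    intro w hw
    have hmem : ∀ t ∈ uIcc (0 : ℝ) 1, (t : ℂ) * w ∈ Metric.ball (0 : ℂ) 1 := by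
      intro t ht
      rw [uIcc_of_le zero_le_one] at ht
      simp only [mem_ball_zero_iff, norm_mul, Complex.norm_real, Real.norm_of_nonneg ht.1] at hw ⊢
      nlinarith [ht.2, norm_nonneg w]
    have hder : ∀ t ∈ uIcc (0 : ℝ) 1, HasDerivAt (fun t : ℝ => g ((t : ℂ) * w))
        (w / (1 - Qpoly N p ((t : ℂ) * w))) t := by
      intro t ht
      have h1 : HasDerivAt (fun t : ℂ => t * w) w (t : ℂ) := by
        simpa using (hasDerivAt_id (t : ℂ)).mul_const w
      have h2 := ((hg _ (hmem t ht)).comp (t : ℂ) h1).comp_ofReal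
      rw [div_eq_mul_one_div, mul_comm]
      exact h2
    have hcont : ContinuousOn (fun t : ℝ => w / (1 - Qpoly N p ((t : ℂ) * w))) (uIcc 0 1) := by
      refine continuousOn_const.div (continuousOn_const.sub
        ((differentiable_Qpoly N p).continuous.comp (by fun_prop)).continuousOn) fun t ht => ?_
      exact one_sub_Qpoly_ne_zero hp0 hp1 (by simpa using hmem t ht)
    have := intervalIntegral.integral_eq_sub_of_hasDerivAt hder hcont.intervalIntegrable
    simpa [phi] using this
  have hball : Metric.ball (0 : ℂ) 1 ∈ 𝓝 z := Metric.isOpen_ball.mem_nhds (by simpa using hz)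
  refine ((hg z (by simpa using hz)).sub_const (g 0)).congr_of_eventuallyEq ?_
  filter_upwards [hball] with w hw using hphi w hw

/-! ### Contraction, Lipschitz and continuity properties in `L1`. -/

theorem norm_toL1_sub_toL1 {f g : ℝ → ℝ} (hf : Integrable f volume)
    (hg : Integrable g volume) :
    ‖(hf.toL1 f : L1) - hg.toL1 g‖ = ∫ x, |f x - g x| := by
  rw [← Integrable.toL1_sub, L1.norm_of_fun_eq_integral_norm]
  rfl

theorem norm_sub_eq_integral (f g : L1) : ‖f - g‖ = ∫ x, |f x - g x| := by
  rw [← dist_eq_norm, L1.dist_eq_integral_dist]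
  rfl

theorem norm_shiftL1_sub_le (f g : L1) : ‖shiftL1 f - shiftL1 g‖ ≤ ‖f - g‖ := by
  have hi : Integrable fun x => |f x - g x| :=
    ((L1.integrable_coeFn f).sub (L1.integrable_coeFn g)).abs
  rw [shiftL1, shiftL1, norm_toL1_sub_toL1, norm_sub_eq_integral,
    ← integral_sub_right_eq_self (fun x => |f x - g x|) 1]
  refine integral_mono_of_nonneg (.of_forall fun _ => abs_nonneg _) (hi.comp_sub_right 1)
    (.of_forall fun x => ?_)
  by_cases h : (2 : ℝ) ≤ x <;> simp [shift, h]

theorem integral_exp_mul_comp (τ : ℝ) (f : ℝ → ℝ) :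
    ∫ x, Real.exp τ * f (Real.exp τ * x) = ∫ x, f x := by
  rw [integral_const_mul, Measure.integral_comp_mul_left, abs_of_pos (inv_pos.2 (Real.exp_pos τ)),
    smul_eq_mul, mul_inv_cancel_left₀ (Real.exp_pos τ).ne']

/-- The dilation preserves the L¹ norm and the cutoff at 1 can only lower it. -/
theorem integral_abs_rescale_sub_le (τ : ℝ) {f g : ℝ → ℝ} (hf : Integrable f)
    (hg : Integrable g) :
    ∫ x, |rescale τ f x - rescale τ g x| ≤ ∫ x, |f x - g x| := by
  rw [← integral_exp_mul_comp τ fun x => |f x - g x|]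
  refine integral_mono_of_nonneg (.of_forall fun _ => abs_nonneg _)
    (((hf.sub hg).abs.comp_mul_left' (Real.exp_pos τ).ne').const_mul _) (.of_forall fun x => ?_)
  by_cases h : (1 : ℝ) ≤ x
  · simp [rescale, h, ← mul_sub, abs_mul]
  · simp only [rescale, mem_Ici, h, not_false_eq_true, indicator_of_notMem, sub_zero, abs_zero]
    exact mul_nonneg (Real.exp_pos _).le (abs_nonneg _)

theorem norm_rescaleL1_sub_le (τ : ℝ) (f g : L1) :
    ‖rescaleL1 τ f - rescaleL1 τ g‖ ≤ ‖f - g‖ := by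
  rw [rescaleL1, rescaleL1, norm_toL1_sub_toL1, norm_sub_eq_integral]
  exact integral_abs_rescale_sub_le τ (L1.integrable_coeFn f) (L1.integrable_coeFn g)

theorem continuous_toL1_rescale {f : ℝ → ℝ} (hf : Integrable f) (hc : Continuous f)
    (hs : HasCompactSupport f) :
    Continuous fun τ => (integrable_rescale τ hf).toL1 (rescale τ f) := by
  refine continuous_iff_continuousAt.2 fun τ₀ => ?_
  rw [ContinuousAt, tendsto_iff_norm_sub_tendsto_zero]
  simp only [norm_toL1_sub_toL1]
  obtain ⟨C, hC⟩ := hc.bounded_above_of_compact_support hs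
  obtain ⟨R, hR⟩ := hs.isCompact.isBounded.subset_closedBall 0
  have hzero : ∀ x, R < |x| → f x = 0 := fun x hx => by
    by_contra h
    have := hR (subset_tsupport _ h)
    simp only [mem_closedBall_zero_iff, Real.norm_eq_abs] at this
    linarith
  have hC0 : 0 ≤ C := (norm_nonneg _).trans (hC 0)
  -- A dominating function uniform for τ near τ₀: e^τ > e^{τ₀-1} confines the support, and e^τ <
  -- e^{τ₀+1} bounds the prefactor.
  have hB : ∀ τ, |τ - τ₀| < 1 → ∀ x, |rescale τ f x| ≤
      (Icc 0 (R * Real.exp (1 - τ₀))).indicator (fun _ => Real.exp (τ₀ + 1) * C) x := by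
    intro τ hτ x
    rw [abs_lt] at hτ
    have hnn : 0 ≤ (Icc 0 (R * Real.exp (1 - τ₀))).indicator
        (fun _ => Real.exp (τ₀ + 1) * C) x :=
      indicator_nonneg (fun _ _ => by positivity) _
    by_cases h1 : 1 ≤ x
    · simp only [rescale, mem_Ici, h1, indicator_of_mem]
      by_cases h2 : x ≤ R * Real.exp (1 - τ₀)
      · have hm : x ∈ Icc 0 (R * Real.exp (1 - τ₀)) := ⟨by linarith, h2⟩
        rw [indicator_of_mem hm, abs_mul,
          abs_of_pos (Real.exp_pos _)]
        exact mul_le_mul (Real.exp_le_exp.2 (by linarith)) (hC _) (abs_nonneg _) (Real.exp_pos _).le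
      · rw [hzero, mul_zero, abs_zero]
        · exact hnn
        · have e : Real.exp (1 - τ₀) * Real.exp τ ≥ 1 := by
            rw [← Real.exp_add]
            exact Real.one_le_exp (by linarith)
          rw [abs_of_pos (mul_pos (Real.exp_pos _) (by linarith))]
          push Not at h2
          have h3 := mul_lt_mul_of_pos_left h2 (Real.exp_pos τ)
          -- `R` comes from a bounding ball and its sign is unknown.
          rcases le_or_gt R 0 with hR0 | hR0
          · exact lt_of_le_of_lt hR0 (mul_pos (Real.exp_pos _) (by linarith))
          · nlinarith
    · simpa [rescale, h1] using hnn
  have hlim := tendsto_integral_filter_of_dominated_convergence (μ := volume) (l := 𝓝 τ₀)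
    (F := fun τ x => |rescale τ f x - rescale τ₀ f x|) (f := fun _ => 0)
    (fun x => 2 * (Icc 0 (R * Real.exp (1 - τ₀))).indicator (fun _ => Real.exp (τ₀ + 1) * C) x)
    (.of_forall fun τ => (((integrable_rescale τ hf).sub
      (integrable_rescale τ₀ hf)).abs).aestronglyMeasurable) ?_ ?_ ?_
  · simpa using hlim
  · filter_upwards [Metric.ball_mem_nhds τ₀ one_pos] with τ hτ
    refine .of_forall fun x => ?_
    rw [Metric.mem_ball, Real.dist_eq] at hτ
    have a1 := hB τ hτ x
    have a2 := hB τ₀ (by simp) x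
    rw [Real.norm_eq_abs, abs_abs]
    have := abs_sub (rescale τ f x) (rescale τ₀ f x)
    linarith
  · refine Integrable.const_mul ?_ 2
    exact (integrable_indicator_iff measurableSet_Icc).2 (integrableOn_const (by simp))
  · refine .of_forall fun x => ?_
    have : Continuous fun τ => |rescale τ f x - rescale τ₀ f x| := by
      by_cases h : (1 : ℝ) ≤ x
      · simp only [rescale, mem_Ici, h, indicator_of_mem]
        fun_prop
      · simp only [rescale, mem_Ici, h, not_false_eq_true, indicator_of_notMem]
        exact continuous_const
    simpa using this.tendsto τ₀

/-- Strong continuity of the rescaling. -/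
theorem continuous_rescaleL1_left (f : L1) : Continuous fun τ => rescaleL1 τ f := by
  -- Compactly supported continuous functions approximate f, and the error stays uniform in τ since
  -- every rescaling is a contraction.
  refine continuous_of_uniform_approx_of_continuous fun u hu => ?_
  obtain ⟨ε, hε, hu⟩ := Metric.mem_uniformity_dist.1 hu
  obtain ⟨g, hgs, hfg, hgc, hgi⟩ :=
    (L1.integrable_coeFn f).exists_hasCompactSupport_integral_sub_le (half_pos hε)
  refine ⟨_, continuous_toL1_rescale hgi hgc hgs, fun τ => hu ?_⟩
  rw [dist_eq_norm, rescaleL1, norm_toL1_sub_toL1]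
  refine (integral_abs_rescale_sub_le τ (L1.integrable_coeFn f) hgi).trans_lt ?_
  simp only [Real.norm_eq_abs] at hfg
  linarith

theorem continuous_rescaleL1 : Continuous fun q : L1 × ℝ => rescaleL1 q.2 q.1 := by
  refine continuous_prod_of_continuous_lipschitzWith _ 1
    (fun f => continuous_rescaleL1_left f) fun τ => ?_
  refine LipschitzWith.of_dist_le_mul fun f g => ?_
  simpa [dist_eq_norm] using norm_rescaleL1_sub_le τ f g

theorem integral_abs_convolution_le {f g : ℝ → ℝ} (hf : Integrable f) (hg : Integrable g) :
    ∫ x, |(f ⋆[ContinuousLinearMap.mul ℝ ℝ, volume] g) x| ≤ (∫ x, |f x|) * ∫ x, |g x| := by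
  have h := integral_convolution (ContinuousLinearMap.mul ℝ ℝ) (μ := volume) (ν := volume)
    hf.abs hg.abs
  rw [ContinuousLinearMap.mul_apply'] at h
  rw [← h]
  refine integral_mono_of_nonneg (.of_forall fun _ => abs_nonneg _)
    (hf.abs.integrable_convolution _ hg.abs) (.of_forall fun x => ?_)
  refine (abs_integral_le_integral_abs (μ := volume)).trans_eq ?_
  simp only [convolution_def, ContinuousLinearMap.mul_apply', abs_mul]

theorem integral_abs_convPow_le {f : ℝ → ℝ} (hf : Integrable f) (k : ℕ) :
    ∫ x, |convPow f k x| ≤ (∫ x, |f x|) ^ (k + 1) := by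
  induction k with
  | zero => simp [convPow]
  | succ k ih =>
    refine (integral_abs_convolution_le hf (integrable_convPow hf k)).trans ?_
    rw [pow_succ' _ (k + 1)]
    exact mul_le_mul_of_nonneg_left ih (integral_nonneg fun _ => abs_nonneg _)

/-- Telescoping: f∗F - g∗G = f∗(F - G) + (f - g)∗G, followed by Young's inequality. The splitting is
only a.e., at points where the three convolution integrals converge. Using |M| keeps the constant
nonnegative whatever the sign of M. -/
theorem exists_integral_abs_convPow_sub_le (M : ℝ) (k : ℕ) :
    ∃ C, 0 ≤ C ∧ ∀ f g : ℝ → ℝ, Integrable f → Integrable g →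
      ∫ x, |f x| ≤ M → ∫ x, |g x| ≤ M →
      ∫ x, |convPow f k x - convPow g k x| ≤ C * ∫ x, |f x - g x| := by
  induction k with
  | zero => exact ⟨1, zero_le_one, fun f g _ _ _ _ => by simp [convPow]⟩
  | succ k ih =>
    obtain ⟨C, hC, h⟩ := ih
    refine ⟨|M| * C + |M| ^ (k + 1), by positivity, fun f g hf hg hfM hgM => ?_⟩
    have hF := integrable_convPow hf k
    have hG := integrable_convPow hg k
    have hd : Integrable fun x => convPow f k x - convPow g k x := hF.sub hG
    have hd' : Integrable fun x => f x - g x := hf.sub hg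
    have hae : ∀ᵐ x, |convPow f (k + 1) x - convPow g (k + 1) x| ≤
        |(f ⋆[ContinuousLinearMap.mul ℝ ℝ, volume]
          fun x => convPow f k x - convPow g k x) x| +
        |((fun x => f x - g x) ⋆[ContinuousLinearMap.mul ℝ ℝ, volume] convPow g k) x| := by
      filter_upwards [hf.ae_convolution_exists (ContinuousLinearMap.mul ℝ ℝ) hF,
        hf.ae_convolution_exists (ContinuousLinearMap.mul ℝ ℝ) hG,
        hg.ae_convolution_exists (ContinuousLinearMap.mul ℝ ℝ) hG] with x h1 h2 h3
      refine le_trans (le_of_eq ?_) (abs_add_le _ _)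
      congr 1
      simp only [ConvolutionExistsAt, ContinuousLinearMap.mul_apply'] at h1 h2 h3
      simp only [convPow, convolution_def, ContinuousLinearMap.mul_apply', mul_sub, sub_mul]
      rw [integral_sub h1 h2, integral_sub h2 h3]
      ring
    have hfi : 0 ≤ ∫ x, |f x - g x| := integral_nonneg fun _ => abs_nonneg _
    have i1 := hf.integrable_convolution (ContinuousLinearMap.mul ℝ ℝ) hd
    have i2 := hd'.integrable_convolution (ContinuousLinearMap.mul ℝ ℝ) hG
    calc ∫ x, |convPow f (k + 1) x - convPow g (k + 1) x|
        ≤ _ := integral_mono_of_nonneg (.of_forall fun _ => abs_nonneg _) (i1.abs.add i2.abs) hae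
      _ = _ := integral_add i1.abs i2.abs
      _ ≤ (∫ x, |f x|) * (∫ x, |convPow f k x - convPow g k x|) +
          (∫ x, |f x - g x|) * ∫ x, |convPow g k x| :=
        add_le_add (integral_abs_convolution_le hf hd) (integral_abs_convolution_le hd' hG)
      _ ≤ |M| * (C * ∫ x, |f x - g x|) + (∫ x, |f x - g x|) * |M| ^ (k + 1) := by
        refine add_le_add (mul_le_mul (hfM.trans (le_abs_self M)) (h f g hf hg hfM hgM)
          (integral_nonneg fun _ => abs_nonneg _) (abs_nonneg M)) ?_
        refine mul_le_mul_of_nonneg_left ((integral_abs_convPow_le hg k).trans ?_) hfi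
        exact pow_le_pow_left₀ (integral_nonneg fun _ => abs_nonneg _)
          (hgM.trans (le_abs_self M)) _
      _ = _ := by ring

/-- `ℚ` is Lipschitz on bounded sets of `L¹`. -/
theorem exists_norm_nonlinL1_sub_le (N : ℕ) (p : ℕ → ℝ) (M : ℝ) :
    ∃ C, 0 ≤ C ∧ ∀ f g : L1, ‖f‖ ≤ M → ‖g‖ ≤ M →
      ‖nonlinL1 N p f - nonlinL1 N p g‖ ≤ C * ‖f - g‖ := by
  choose C hC h using exists_integral_abs_convPow_sub_le M
  refine ⟨∑ j ∈ Finset.Icc 1 N, |p j| * C (j - 1),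
    Finset.sum_nonneg fun j _ => mul_nonneg (abs_nonneg _) (hC _), fun f g hf hg => ?_⟩
  have hfi := L1.integrable_coeFn f
  have hgi := L1.integrable_coeFn g
  rw [L1.norm_eq_integral_norm] at hf hg
  rw [nonlinL1, nonlinL1, norm_toL1_sub_toL1, norm_sub_eq_integral, Finset.sum_mul]
  have hi : ∀ j ∈ Finset.Icc 1 N, Integrable
      fun x => |p j| * |convPow f (j - 1) x - convPow g (j - 1) x| := fun j _ =>
    ((integrable_convPow hfi _).sub (integrable_convPow hgi _)).abs.const_mul _
  calc ∫ x, |nonlin N p f x - nonlin N p g x|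
      ≤ ∫ x, ∑ j ∈ Finset.Icc 1 N, |p j| * |convPow f (j - 1) x - convPow g (j - 1) x| := by
        refine integral_mono_of_nonneg (.of_forall fun _ => abs_nonneg _)
          (integrable_finsetSum _ hi) (.of_forall fun x => ?_)
        simp only [nonlin, ← Finset.sum_sub_distrib, ← mul_sub]
        refine (Finset.abs_sum_le_sum_abs _ _).trans (le_of_eq ?_)
        simp only [abs_mul]
    _ = ∑ j ∈ Finset.Icc 1 N, |p j| * ∫ x, |convPow f (j - 1) x - convPow g (j - 1) x| := by
        rw [integral_finsetSum _ hi]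
        simp only [integral_const_mul]
    _ ≤ _ := by
        refine Finset.sum_le_sum fun j _ => ?_
        rw [mul_assoc]
        exact mul_le_mul_of_nonneg_left (h _ f g hfi hgi hf hg) (abs_nonneg _)

theorem continuous_nonlinL1 (N : ℕ) (p : ℕ → ℝ) : Continuous (nonlinL1 N p) := by
  refine LocallyLipschitz.continuous fun f => ?_
  obtain ⟨C, hC, h⟩ := exists_norm_nonlinL1_sub_le N p (‖f‖ + 1)
  refine ⟨⟨C, hC⟩, Metric.ball f 1, Metric.ball_mem_nhds f one_pos,
    LipschitzOnWith.of_dist_le_mul fun g₁ h₁ g₂ h₂ => ?_⟩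
  have hb : ∀ g ∈ Metric.ball f 1, ‖g‖ ≤ ‖f‖ + 1 := by
    intro g hg
    rw [mem_ball_iff_norm] at hg
    have := norm_le_norm_add_norm_sub' g f
    linarith
  rw [dist_eq_norm, dist_eq_norm]
  exact h g₁ g₂ (hb _ h₁) (hb _ h₂)

theorem continuous_shiftL1 : Continuous shiftL1 :=
  (LipschitzWith.of_dist_le_mul (K := 1) fun f g => by
    simpa [dist_eq_norm] using norm_shiftL1_sub_le f g).continuous

theorem continuousOn_rescaleL1_shiftL1_nonlinL1 (N : ℕ) (p : ℕ → ℝ) {η : ℝ → L1} {S : Set ℝ}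
    (hη : ContinuousOn η S) (τ : ℝ) :
    ContinuousOn (fun s => rescaleL1 (τ - s) (shiftL1 (nonlinL1 N p (η s)))) S :=
  continuous_rescaleL1.comp_continuousOn
    (((continuous_shiftL1.comp (continuous_nonlinL1 N p)).comp_continuousOn hη).prodMk
      (by fun_prop))

/-- Integral form of Grönwall's lemma with vanishing initial value. -/
theorem eq_zero_of_le_mul_integral {u : ℝ → ℝ} {K T : ℝ} (hc : ContinuousOn u (Icc 0 T))
    (h0 : ∀ t ∈ Icc 0 T, 0 ≤ u t)
    (h : ∀ t ∈ Icc 0 T, u t ≤ K * ∫ s in (0 : ℝ)..t, u s) : ∀ t ∈ Icc 0 T, u t = 0 := by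
  rcases lt_or_ge T 0 with hT | hT
  · intro t ht
    linarith [ht.1, ht.2]
  -- A continuous extension to the whole line makes the primitive differentiable everywhere.
  set v := IccExtend hT ((Icc 0 T).domRestrict u) with hv
  have hvc : Continuous v := hc.domRestrict.Icc_extend'
  have hvu : ∀ t ∈ Icc 0 T, v t = u t := fun t ht => by
    rw [hv, IccExtend_of_mem _ _ ht]; rfl
  have hint : ∀ t ∈ Icc 0 T, ∫ s in (0 : ℝ)..t, u s = ∫ s in (0 : ℝ)..t, v s := fun t ht => by
    refine intervalIntegral.integral_congr fun s hs => (hvu s ?_).symm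
    rw [uIcc_of_le ht.1] at hs
    exact ⟨hs.1, hs.2.trans ht.2⟩
  have hder : ∀ t, HasDerivAt (fun t => ∫ s in (0 : ℝ)..t, v s) (v t) t := fun t =>
    hvc.integral_hasStrictDerivAt 0 t |>.hasDerivAt
  have hnn : ∀ t ∈ Icc 0 T, 0 ≤ ∫ s in (0 : ℝ)..t, v s := fun t ht =>
    intervalIntegral.integral_nonneg ht.1 fun s hs => by
      have hs' : s ∈ Icc 0 T := ⟨hs.1, hs.2.trans ht.2⟩
      rw [hvu s hs']
      exact h0 s hs'
  -- The differential Grönwall lemma is applied to the primitive U of u: U(0) = 0 and |U'| ≤ K |U|.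
  have key := eq_zero_of_abs_deriv_le_mul_abs_self_of_eq_zero_right (K := K)
    (f := fun t => ∫ s in (0 : ℝ)..t, v s) (f' := v) (a := 0) (b := T)
    (fun t _ => (hder t).continuousAt.continuousWithinAt)
    (fun t _ => (hder t).hasDerivWithinAt) (by simp) fun t ht => by
      have ht' := Ico_subset_Icc_self ht
      rw [hvu t ht', Real.norm_of_nonneg (h0 t ht'), Real.norm_of_nonneg (hnn t ht'),
        ← hint t ht']
      exact h t ht'
  intro t ht
  refine le_antisymm ((h t ht).trans ?_) (h0 t ht)
  rw [hint t ht, key t ht, mul_zero]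

/-! ### Tails as functionals separating the points of `L1`. -/

/-- The tail `f ↦ ∫_a^∞ f` as a continuous linear functional on `L¹`. -/
def tailCLM (a : ℝ) : L1 →L[ℝ] ℝ :=
  LinearMap.mkContinuous
    { toFun := fun f => tail f a
      map_add' := fun f g => by
        rw [tail, setIntegral_congr_ae (g := fun x => f x + g x) measurableSet_Ioi
          ((Lp.coeFn_add f g).mono fun x hx _ => hx)]
        exact integral_add (L1.integrable_coeFn f).integrableOn (L1.integrable_coeFn g).integrableOn
      map_smul' := fun c f => by
        rw [tail, setIntegral_congr_ae (g := fun x => c * f x) measurableSet_Ioi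
          ((Lp.coeFn_smul c f).mono fun x hx _ => hx)]
        exact integral_const_mul _ _ } 1 fun f => by
      rw [one_mul, L1.norm_eq_integral_norm]
      exact abs_tail_le (L1.integrable_coeFn f) a

theorem tailCLM_apply (a : ℝ) (f : L1) : tailCLM a f = tail f a := rfl

theorem tail_congr {f g : ℝ → ℝ} (h : f =ᵐ[volume] g) : tail f = tail g := by
  ext a
  exact setIntegral_congr_ae measurableSet_Ioi (h.mono fun x hx _ => hx)

/-- Substitution y ↦ e^τ y; the cutoff in `rescale` is the source of the maximum with 1. -/
theorem tail_rescale (τ : ℝ) (f : ℝ → ℝ) (a : ℝ) :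
    tail (rescale τ f) a = tail f (Real.exp τ * max a 1) := by
  have h1 : rescale τ f =ᵐ[volume]
      (Ioi (1 : ℝ)).indicator fun y => Real.exp τ * f (Real.exp τ * y) :=
    indicator_ae_eq_of_ae_eq_set Ioi_ae_eq_Ici.symm
  rw [tail_congr h1, tail, setIntegral_indicator measurableSet_Ioi, Ioi_inter_Ioi,
    integral_const_mul, integral_comp_mul_left_Ioi _ _ (Real.exp_pos τ), smul_eq_mul,
    mul_inv_cancel_left₀ (Real.exp_pos τ).ne', tail]

theorem tail_rescaleL1 (τ : ℝ) (f : L1) (a : ℝ) :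
    tail (rescaleL1 τ f) a = tail f (Real.exp τ * max a 1) := by
  rw [← tail_rescale]
  exact congrFun (tail_congr (Integrable.coeFn_toL1 _)) a

theorem tail_max_one {f : ℝ → ℝ} (hi : Integrable f) (hf : ∀ᵐ y : ℝ, y < 1 → f y = 0) (a : ℝ) :
    tail f (max a 1) = tail f a := by
  rcases le_total a 1 with h | h
  · rw [max_eq_right h, ← sub_eq_zero, ← neg_sub, tail_sub_tail hi, neg_eq_zero,
      intervalIntegral.integral_of_le h, integral_Ioc_eq_integral_Ioo]
    exact setIntegral_eq_zero_of_ae_eq_zero (hf.mono fun x hx hx' => hx hx'.2)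
  · rw [max_eq_left h]

/-- Lebesgue differentiation of a primitive that vanishes to the right of c. -/
theorem ae_eq_zero_of_intervalIntegral_eq_zero {d : ℝ → ℝ} (hd : LocallyIntegrable d)
    {c : ℝ} (h : ∀ b, c < b → ∫ x in c..b, d x = 0) : ∀ᵐ x : ℝ, c < x → d x = 0 := by
  filter_upwards [LocallyIntegrable.ae_hasDerivAt_integral hd] with x hx hcx
  have h1 : HasDerivAt (fun _ : ℝ => (0 : ℝ)) (d x) x := by
    refine (hx c).congr_of_eventuallyEq ?_
    filter_upwards [lt_mem_nhds hcx] with b hb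
    exact (h b hb).symm
  exact h1.unique (hasDerivAt_const x 0)

theorem eq_of_tail_eq {f g : L1} (h : ∀ a, tail f a = tail g a) : f = g := by
  have hf := L1.integrable_coeFn f
  have hg := L1.integrable_coeFn g
  have key : ∀ n : ℕ, ∀ᵐ x : ℝ, -(n : ℝ) < x → f x - g x = 0 := fun n => by
    refine ae_eq_zero_of_intervalIntegral_eq_zero (hf.sub hg).locallyIntegrable fun b _ => ?_
    simp only [Pi.sub_apply]
    rw [intervalIntegral.integral_sub hf.intervalIntegrable hg.intervalIntegrable,
      ← tail_sub_tail hf, ← tail_sub_tail hg, h, h, sub_self]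
  refine Lp.ext ?_
  filter_upwards [ae_all_iff.2 key] with x hx
  obtain ⟨n, hn⟩ := exists_nat_gt (-x)
  exact sub_eq_zero.1 (hx n (by linarith))

/-! ### The integrated relation and the unit tail up to y = 2. -/

/-- Integrated form of the steady-state equation: `y f(y) = β ∫_y^∞ T₁ℚ[f]` for a.e. `y > 1`. -/
def SteadyRelation (N : ℕ) (p : ℕ → ℝ) (β : ℝ) (f : ℝ → ℝ) : Prop :=
  ∀ᵐ y : ℝ, 1 < y → y * f y = β * tail (shift (nonlin N p f)) y

/-- Probability densities on `(1, ∞)`, as functions extended by zero. -/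
structure IsDensity (f : ℝ → ℝ) : Prop where
  integrable : Integrable f
  eq_zero : ∀ᵐ y : ℝ, y < 1 → f y = 0
  nonneg : ∀ᵐ y : ℝ, 0 ≤ f y
  integral_eq_one : ∫ y, f y = 1

theorem isDensity_of_mem {f : L1} (hf : f ∈ probDensities) : IsDensity f where
  integrable := L1.integrable_coeFn f
  eq_zero := hf.1
  nonneg := hf.2.1
  integral_eq_one := by rw [← setIntegral_Ioi_one_eq_integral hf.1]; exact hf.2.2

/-- `shift` vanishes below 2, so the tail from any y ≤ 2 is the full mass. This yields both the
initial value of the differential equation and y f(y) = β on [1,2], hence the constant trace. -/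
theorem tail_shift_nonlin_eq_one {N : ℕ} {p : ℕ → ℝ} (hp1 : ∑ j ∈ Finset.Icc 1 N, p j = 1)
    {f : ℝ → ℝ} (hf : IsDensity f) {y : ℝ} (hy : y ≤ 2) :
    tail (shift (nonlin N p f)) y = 1 := by
  rw [← integral_shift_nonlin N p hp1 hf.integrable hf.eq_zero hf.integral_eq_one, tail,
    ← integral_indicator measurableSet_Ioi]
  refine integral_congr_ae ?_
  filter_upwards [Measure.ae_ne volume (2 : ℝ)] with x hx
  by_cases h : y < x
  · simp [h]
  · have h2 : ¬ (2 : ℝ) ≤ x := fun h2 => hx (le_antisymm (by linarith) h2)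
    simp [h, shift, h2]

/-! ### The relation and the differential equation -/

theorem SolvesSteadyODE.steadyRelation {N : ℕ} {p : ℕ → ℝ}
    (hp1 : ∑ j ∈ Finset.Icc 1 N, p j = 1) {f : ℝ → ℝ} (hf : IsDensity f) {β : ℝ} {η : ℝ → ℝ}
    (hη : SolvesSteadyODE N p β η) (hfη : ∀ᵐ y : ℝ, 1 < y → f y = η y) :
    SteadyRelation N p β f := by
  have hE : (Ici (1 : ℝ)).indicator η =ᵐ[volume] f := by
    filter_upwards [hfη, hf.eq_zero, Measure.ae_ne volume (1 : ℝ)] with x h1 h2 h3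
    rcases lt_or_gt_of_ne h3 with h | h
    · simp [h2 h, h.not_ge]
    · simp [h1 h, h.le]
  have hh := shift_congr (nonlin_congr N p hE)
  have hi := integrable_shift (integrable_nonlin N p hf.integrable)
  filter_upwards [hfη] with y hy h1
  have hder := (hη.absCont y h1).integral_deriv_eq_sub
  -- Integration from 1 to y gives y η(y) = β - β ∫_1^y k, and 1 is the tail of k at 1.
  have : ∫ x in (1 : ℝ)..y, deriv (fun y => y * η y) x =
      ∫ x in (1 : ℝ)..y, -(β * shift (nonlin N p f) x) := by
    refine intervalIntegral.integral_congr_ae ?_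
    filter_upwards [hη.ode, hh] with x hx1 hx2 hx
    rw [uIoc_of_le h1.le] at hx
    rw [(hx1 hx.1).deriv, hx2]
  rw [this, intervalIntegral.integral_neg, intervalIntegral.integral_const_mul, ← tail_sub_tail hi,
    tail_shift_nonlin_eq_one hp1 hf one_le_two, hη.initial] at hder
  rw [hy h1]
  linarith

theorem absolutelyContinuousOnInterval_congr {f g : ℝ → ℝ} {a b : ℝ}
    (hf : AbsolutelyContinuousOnInterval f a b) (hfg : EqOn f g (uIcc a b)) :
    AbsolutelyContinuousOnInterval g a b := by
  rw [absolutelyContinuousOnInterval_iff] at hf ⊢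
  intro ε hε
  obtain ⟨δ, hδ, h⟩ := hf ε hε
  refine ⟨δ, hδ, fun E hE hE' => ?_⟩
  convert h E hE hE' using 1
  refine Finset.sum_congr rfl fun i hi => ?_
  rw [hfg (hE.1 i hi).1, hfg (hE.1 i hi).2]

theorem SteadyRelation.exists_solvesSteadyODE {N : ℕ} {p : ℕ → ℝ}
    (hp1 : ∑ j ∈ Finset.Icc 1 N, p j = 1) {f : ℝ → ℝ} (hf : IsDensity f) {β : ℝ}
    (h : SteadyRelation N p β f) :
    ∃ η : ℝ → ℝ, SolvesSteadyODE N p β η ∧ ∀ᵐ y : ℝ, 1 < y → f y = η y := by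
  have hi := integrable_shift (integrable_nonlin N p hf.integrable)
  set k := shift (nonlin N p f) with hk
  have hfη : ∀ᵐ y : ℝ, 1 < y → f y = β * tail k y / y := by
    filter_upwards [h] with y hy h1
    rw [← hy h1, mul_div_cancel_left₀ _ (by positivity)]
  have hE : (Ici (1 : ℝ)).indicator (fun y => β * tail k y / y) =ᵐ[volume] f := by
    filter_upwards [hfη, hf.eq_zero, Measure.ae_ne volume (1 : ℝ)] with x h1 h2 h3
    rcases lt_or_gt_of_ne h3 with h | h
    · simp [h2 h, h.not_ge]
    · simp [h1 h, h.le]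
  -- The representative β·tail/y is dictated by the relation. Multiplied by y it becomes a constant
  -- minus a primitive of an integrable function, hence absolutely continuous and a.e.
  -- differentiable.
  have hmul : ∀ y : ℝ, 0 < y → y * (β * tail k y / y) = β * (tail k 1 - ∫ x in (1 : ℝ)..y, k x) := by
    intro y hy
    rw [← tail_sub_tail hi]
    field_simp
    ring
  refine ⟨fun y => β * tail k y / y, ⟨?_, fun R hR => ?_, ?_⟩, hfη⟩
  · rw [tail_shift_nonlin_eq_one hp1 hf one_le_two]
    simp
  · have hac := (hi.intervalIntegrable
      (a := 1) (b := R)).absolutelyContinuousOnInterval_intervalIntegral (left_mem_uIcc)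
    have hc : AbsolutelyContinuousOnInterval (fun _ : ℝ => tail k 1) 1 R := by
      rw [absolutelyContinuousOnInterval_iff]
      exact fun ε hε => ⟨1, one_pos, fun E _ _ => by simpa using hε⟩
    refine absolutelyContinuousOnInterval_congr ((hc.sub hac).const_mul β) fun x hx => ?_
    rw [uIcc_of_le hR.le] at hx
    exact (hmul x (by linarith [hx.1])).symm
  · filter_upwards [LocallyIntegrable.ae_hasDerivAt_integral hi.locallyIntegrable,
      shift_congr (nonlin_congr N p hE)] with y hy hy2 h1
    rw [hy2, ← mul_neg, ← zero_sub]
    refine HasDerivAt.congr_of_eventuallyEq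
      (((hasDerivAt_const y (tail k 1)).sub (hy 1)).const_mul β) ?_
    filter_upwards [lt_mem_nhds (zero_lt_one.trans h1)] with x hx
    exact hmul x hx

/-! ### The relation and the nonlinear transformation -/

theorem laplace_congr {f g : ℝ → ℝ} (h : ∀ᵐ y : ℝ, 1 < y → f y = g y) (s : ℂ) :
    laplace f s = laplace g s :=
  setIntegral_congr_ae measurableSet_Ioi (h.mono fun x hx h1 => by simp only [twist, hx h1])

theorem laplace_const_mul (c : ℝ) (f : ℝ → ℝ) (s : ℂ) :
    laplace (fun x => c * f x) s = c * laplace f s := by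
  rw [laplace, laplace, ← integral_const_mul]
  congr 1 with x
  simp only [twist]
  push_cast
  ring

theorem twist_sub (s : ℂ) (f g : ℝ → ℝ) (x : ℝ) :
    twist s (fun x => f x - g x) x = twist s f x - twist s g x := by
  simp only [twist]
  push_cast
  ring

theorem twist_const_mul (s : ℂ) (c : ℝ) (f : ℝ → ℝ) :
    twist s (fun x => c * f x) = fun x => (c : ℂ) * twist s f x := by
  ext x
  simp only [twist]
  push_cast
  ring

theorem laplace_sub {f g : ℝ → ℝ} {s : ℂ} (hf : IntegrableOn (twist s f) (Ioi 1))
    (hg : IntegrableOn (twist s g) (Ioi 1)) :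
    laplace (fun x => f x - g x) s = laplace f s - laplace g s := by
  rw [laplace, laplace, laplace, ← integral_sub hf hg]
  simp only [twist_sub]

theorem IsDensity.norm_laplace_lt_one {f : ℝ → ℝ} (hf : IsDensity f) {s : ℂ} (hs : 0 < s.re) :
    ‖laplace f s‖ < 1 := by
  have h1 : ‖laplace f s‖ ≤ ∫ x in Ioi (1 : ℝ), Real.exp (-s.re) * f x := by
    refine norm_integral_le_of_norm_le (hf.integrable.integrableOn.const_mul _) ?_
    filter_upwards [ae_restrict_mem measurableSet_Ioi, ae_restrict_of_ae hf.nonneg] with x hx h0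
    rw [norm_twist, abs_of_nonneg h0]
    refine mul_le_mul_of_nonneg_right (Real.exp_le_exp.2 ?_) h0
    have : (1 : ℝ) < x := hx
    nlinarith
  rw [integral_const_mul, setIntegral_Ioi_one_eq_integral hf.eq_zero, hf.integral_eq_one,
    mul_one] at h1
  exact h1.trans_lt (Real.exp_lt_one_iff.2 (by linarith))

theorem IsDensity.laplaceIntegrable {f : ℝ → ℝ} (hf : IsDensity f) : LaplaceIntegrable f :=
  laplaceIntegrable_of_integrable hf.integrable

theorem laplace_eq_integral {f : ℝ → ℝ} (hf : ∀ᵐ y : ℝ, y < 1 → f y = 0) (s : ℂ) :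
    laplace f s = ∫ x, twist s f x :=
  setIntegral_Ioi_one_eq_integral (hf.mono fun x hx h1 => by simp [twist, hx h1])

/-- `mul_laplace_tail` with unit tail at 1; the shift contributes e^{-s} and the convolution powers
contribute Q of the transform. -/
theorem IsDensity.laplace_tail {N : ℕ} {p : ℕ → ℝ} (hp1 : ∑ j ∈ Finset.Icc 1 N, p j = 1)
    {f : ℝ → ℝ} (hf : IsDensity f) {s : ℂ} (hs : 0 < s.re) :
    laplace (tail (shift (nonlin N p f))) s =
      Complex.exp (-s) / s * (1 - Qpoly N p (laplace f s)) := by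
  have hs0 : s ≠ 0 := by rintro rfl; simp at hs
  have htw : Integrable (twist s f) := by
    have h : IntegrableOn (twist s f) (Ici 1) :=
      (integrableOn_Ici_iff_integrableOn_Ioi (by simp)).2 (hf.laplaceIntegrable s hs)
    refine h.integrable_of_ae_notMem_eq_zero (hf.eq_zero.mono fun x hx h1 => ?_)
    simp [twist, hx (not_le.1 h1)]
  have hz : ∀ᵐ y : ℝ, y < 1 → shift (nonlin N p f) y = 0 := .of_forall fun y hy => by
    have : ¬ (2 : ℝ) ≤ y := by linarith
    simp [shift, this]
  have key := mul_laplace_tail (integrable_shift (integrable_nonlin N p hf.integrable)) hs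
  rw [tail_shift_nonlin_eq_one hp1 hf one_le_two, laplace_eq_integral hz,
    integral_twist_shift (nonlin_ae_eq_zero N p hf.eq_zero), (twist_nonlin N p htw).2,
    ← laplace_eq_integral hf.eq_zero] at key
  rw [div_mul_eq_mul_div, eq_div_iff hs0, mul_comm, key]
  push_cast
  ring

theorem IsDensity.hasDerivAt_phi_laplace {N : ℕ} {p : ℕ → ℝ}
    (hp0 : ∀ j ∈ Finset.Icc 1 N, 0 ≤ p j) (hp1 : ∑ j ∈ Finset.Icc 1 N, p j = 1)
    {f : ℝ → ℝ} (hf : IsDensity f) {s : ℂ} (hs : 0 < s.re) :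
    HasDerivAt (fun s => phi N p (laplace f s))
      (1 / (1 - Qpoly N p (laplace f s)) * -laplace (fun x => x * f x) s) s :=
  (hasDerivAt_phi hp0 hp1 (hf.norm_laplace_lt_one hs)).comp s
    (hf.laplaceIntegrable.hasDerivAt hs).2

theorem hasDerivAt_laplace_wStar (β : ℝ) {s : ℂ} (hs : 0 < s.re) :
    HasDerivAt (fun s => (β : ℂ) * laplace wStar s) (β * -(Complex.exp (-s) / s)) s := by
  have := ((laplaceIntegrable_wStar.hasDerivAt hs).2).const_mul (β : ℂ)
  rwa [laplace_id_mul_wStar hs] at this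

/-- By the chain rule both sides have derivative -β e^{-s}/s, the factor 1 - Q cancelling. Their
difference is constant on the connected half-plane and tends to 0 along the positive reals, since
`phi` vanishes at 0. -/
theorem SteadyRelation.phi_laplace {N : ℕ} {p : ℕ → ℝ}
    (hp0 : ∀ j ∈ Finset.Icc 1 N, 0 ≤ p j) (hp1 : ∑ j ∈ Finset.Icc 1 N, p j = 1)
    {f : ℝ → ℝ} (hf : IsDensity f) {β : ℝ} (h : SteadyRelation N p β f) {s : ℂ}
    (hs : 0 < s.re) : phi N p (laplace f s) = β * laplace wStar s := by
  set D : ℂ → ℂ := fun s => phi N p (laplace f s) - β * laplace wStar s with hD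
  have hder : ∀ s ∈ {s : ℂ | 0 < s.re}, HasDerivAt D 0 s := by
    intro s hs
    have hs' : 0 < s.re := hs
    have key := (hf.hasDerivAt_phi_laplace hp0 hp1 hs').fun_sub (hasDerivAt_laplace_wStar β hs')
    have hne := one_sub_Qpoly_ne_zero hp0 hp1 (hf.norm_laplace_lt_one hs')
    have hzero : 1 / (1 - Qpoly N p (laplace f s)) * -laplace (fun x => x * f x) s -
        β * -(Complex.exp (-s) / s) = 0 := by
      rw [laplace_congr h, laplace_const_mul, hf.laplace_tail hp1 hs']
      field_simp
      ring
    rwa [hzero] at key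
  have hopen : IsOpen {s : ℂ | 0 < s.re} := isOpen_lt continuous_const Complex.continuous_re
  have hconst : ∀ t ∈ {s : ℂ | 0 < s.re}, D t = D s := fun t ht =>
    hopen.is_const_of_deriv_eq_zero (convex_halfSpace_re_gt 0).isPreconnected
      (fun s hs => (hder s hs).differentiableAt.differentiableWithinAt)
      (fun s hs => (hder s hs).deriv) ht hs
  have h0 : ContinuousAt (phi N p) 0 := (hasDerivAt_phi hp0 hp1 (by simp)).continuousAt
  have hlim : Tendsto (fun t : ℝ => D t) atTop (𝓝 0) := by
    have h1 : Tendsto (fun t : ℝ => phi N p (laplace f t)) atTop (𝓝 (phi N p 0)) :=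
      h0.tendsto.comp hf.laplaceIntegrable.tendsto_zero
    have h2 := (laplaceIntegrable_wStar.tendsto_zero).const_mul (β : ℂ)
    simpa [phi_zero] using h1.sub h2
  have hlim' : Tendsto (fun t : ℝ => D t) atTop (𝓝 (D s)) := by
    refine tendsto_const_nhds.congr' ?_
    filter_upwards [eventually_gt_atTop 0] with t ht
    exact (hconst t (by simpa using ht)).symm
  exact sub_eq_zero.1 (tendsto_nhds_unique hlim' hlim)

theorem IsTransformOf.twist_integrable {N : ℕ} {p : ℕ → ℝ} {f w : ℝ → ℝ}
    (h : IsTransformOf N p f w) : LaplaceIntegrable w := fun s hs => by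
  have h1 := h.integrable (-(Complex.I * s)) (by simpa using hs)
  simp only [mul_neg, ← mul_assoc, Complex.I_mul_I, neg_mul, one_mul, neg_neg] at h1
  exact h1

theorem IsTransformOf.laplace_eq {N : ℕ} {p : ℕ → ℝ} {f w : ℝ → ℝ}
    (h : IsTransformOf N p f w) {s : ℂ} (hs : 0 < s.re) :
    laplace w s = phi N p (laplace f s) := by
  have h1 := h.transform_eq (-(Complex.I * s)) (by simpa using hs)
  simpa only [fourierLaplace_eq_laplace, mul_neg, ← mul_assoc, Complex.I_mul_I, neg_mul, one_mul,
    neg_neg] using h1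

theorem IsTransformOf.ae_eq {N : ℕ} {p : ℕ → ℝ} {f w₁ w₂ : ℝ → ℝ}
    (h₁ : IsTransformOf N p f w₁) (h₂ : IsTransformOf N p f w₂) : ∀ᵐ y : ℝ, w₁ y = w₂ y := by
  have hs1 : 0 < (1 : ℂ).re := by simp
  have hi : IntegrableOn (twist 1 fun x => w₁ x - w₂ x) (Ioi 1) := by
    simp only [funext (twist_sub 1 w₁ w₂)]
    exact (h₁.twist_integrable 1 hs1).sub (h₂.twist_integrable 1 hs1)
  have := ae_eq_zero_of_laplace_eq_zero hi fun s hs => by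
    rw [laplace_sub (h₁.twist_integrable s hs) (h₂.twist_integrable s hs), h₁.laplace_eq hs,
      h₂.laplace_eq hs, sub_self]
  filter_upwards [this, Measure.ae_ne volume (1 : ℝ)] with x hx hx1
  rcases lt_or_gt_of_ne hx1 with h | h
  · rw [h₁.eq_zero x h, h₂.eq_zero x h]
  · exact sub_eq_zero.1 (hx h)

theorem SteadyRelation.isTransformOf {N : ℕ} {p : ℕ → ℝ}
    (hp0 : ∀ j ∈ Finset.Icc 1 N, 0 ≤ p j) (hp1 : ∑ j ∈ Finset.Icc 1 N, p j = 1)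
    {f : ℝ → ℝ} (hf : IsDensity f) {β : ℝ} (h : SteadyRelation N p β f) :
    IsTransformOf N p f fun y => β * wStar y where
  locallyIntegrable := by
    have hb : LocallyIntegrable fun y => β * wStar y := by
      refine (locallyIntegrable_const |β|).mono
        (measurable_wStar.const_mul β).aestronglyMeasurable (.of_forall fun x => ?_)
      rw [Real.norm_eq_abs, abs_mul, Real.norm_eq_abs, abs_abs]
      exact mul_le_of_le_one_right (abs_nonneg _) (abs_wStar_le x)
    exact hb.locallyIntegrableOn _
  eq_zero x hx := by simp [wStar, not_le.2 hx]
  integrable ξ hξ := by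
    have := laplaceIntegrable_wStar (Complex.I * ξ) (by simpa using hξ)
    change IntegrableOn (twist (Complex.I * ξ) fun y => β * wStar y) (Ioi 1)
    rw [twist_const_mul]
    exact Integrable.const_mul this _
  transform_eq ξ hξ := by
    rw [fourierLaplace_eq_laplace, fourierLaplace_eq_laplace, laplace_const_mul,
      h.phi_laplace hp0 hp1 hf (by simpa using hξ)]

theorem SteadyRelation.calN_ae_eq {N : ℕ} {p : ℕ → ℝ}
    (hp0 : ∀ j ∈ Finset.Icc 1 N, 0 ≤ p j) (hp1 : ∑ j ∈ Finset.Icc 1 N, p j = 1)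
    {f : ℝ → ℝ} (hf : IsDensity f) {β : ℝ} (h : SteadyRelation N p β f) :
    ∀ᵐ y : ℝ, calN N p f y = β * wStar y := by
  have hex : ∃ w, IsTransformOf N p f w := ⟨_, h.isTransformOf hp0 hp1 hf⟩
  rw [calN, dif_pos hex]
  exact hex.choose_spec.ae_eq (h.isTransformOf hp0 hp1 hf)

theorem steadyRelation_of_calN_ae_eq {N : ℕ} {p : ℕ → ℝ}
    (hp0 : ∀ j ∈ Finset.Icc 1 N, 0 ≤ p j) (hp1 : ∑ j ∈ Finset.Icc 1 N, p j = 1)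
    {f : ℝ → ℝ} (hf : IsDensity f) {β : ℝ} (hβ : 0 < β)
    (h : ∀ᵐ y : ℝ, calN N p f y = β * wStar y) : SteadyRelation N p β f := by
  have hex : ∃ w, IsTransformOf N p f w := by
    -- The default value 0 of `calN` is incompatible with β w* > 0 on (1,2); this is where β > 0
    -- enters.
    by_contra hex
    rw [calN, dif_neg hex] at h
    have h1 : ∀ᵐ y : ℝ, y ∉ Ioo (1 : ℝ) 2 := by
      filter_upwards [h] with y hy hy'
      rw [wStar_of_one_le hy'.1.le] at hy
      have : 0 < β * (1 / y) := mul_pos hβ (one_div_pos.2 (by linarith [hy'.1]))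
      simp only [Pi.zero_apply] at hy
      linarith
    have h2 := measure_eq_zero_iff_ae_notMem.2 h1
    rw [Real.volume_Ioo] at h2
    norm_num at h2
  rw [calN, dif_pos hex] at h
  set w := hex.choose
  have hw : IsTransformOf N p f w := hex.choose_spec
  have hphi : ∀ s : ℂ, 0 < s.re → phi N p (laplace f s) = β * laplace wStar s := fun s hs => by
    rw [← hw.laplace_eq hs, laplace_congr (h.mono fun y hy _ => hy), laplace_const_mul]
  have hi := integrable_shift (integrable_nonlin N p hf.integrable)
  set k := shift (nonlin N p f) with hk
  have hI1 : ∀ s : ℂ, 0 < s.re → IntegrableOn (twist s fun x => x * f x) (Ioi 1) :=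
    fun s hs => (hf.laplaceIntegrable.hasDerivAt hs).1
  have hI2 : ∀ s : ℂ, 0 < s.re → IntegrableOn (twist s fun x => β * tail k x) (Ioi 1) :=
    fun s hs => by
      rw [twist_const_mul]
      exact Integrable.const_mul (laplaceIntegrable_tail hi s hs) _
  have hopen : IsOpen {s : ℂ | 0 < s.re} := isOpen_lt continuous_const Complex.continuous_re
  have hs1 : 0 < (1 : ℂ).re := by simp
  -- Differentiating φ(F) = β ŵ* in s shows that x f(x) and β times the tail have the same
  -- transform.
  have key := ae_eq_zero_of_laplace_eq_zero (f := fun x => x * f x - β * tail k x) (by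
      simp only [funext (twist_sub 1 (fun x => x * f x) fun x => β * tail k x)]
      exact (hI1 1 hs1).sub (hI2 1 hs1)) fun s hs => by
    have hd : HasDerivAt (fun s => phi N p (laplace f s)) (β * -(Complex.exp (-s) / s)) s := by
      refine (hasDerivAt_laplace_wStar β hs).congr_of_eventuallyEq ?_
      filter_upwards [hopen.mem_nhds hs] with t ht using hphi t ht
    have heq := (hf.hasDerivAt_phi_laplace hp0 hp1 hs).unique hd
    have hne := one_sub_Qpoly_ne_zero hp0 hp1 (hf.norm_laplace_lt_one hs)
    rw [laplace_sub (hI1 s hs) (hI2 s hs), laplace_const_mul, hf.laplace_tail hp1 hs]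
    rw [one_div_mul_eq_div, div_eq_iff hne] at heq
    linear_combination -heq
  filter_upwards [key] with y hy h1
  exact sub_eq_zero.1 (hy h1)

/-! ### The relation and the evolution equation -/

/-- The logarithm is differentiable on (0,∞) and so maps null sets to null sets. This transfers a.e.
statements in y to the trace variable τ, where y = e^{τ-τ₀}. -/
theorem ae_comp_exp_sub {P : ℝ → Prop} (h : ∀ᵐ y : ℝ, P y) (τ₀ : ℝ) :
    ∀ᵐ τ : ℝ, P (Real.exp (τ - τ₀)) := by
  have h1 : ∀ᵐ t : ℝ, P (Real.exp t) := by
    rw [ae_iff] at h ⊢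
    have himg := addHaar_image_eq_zero_of_differentiableOn_of_addHaar_eq_zero volume
      (f := Real.log) (s := {y | ¬ P y} ∩ Ioi 0)
      (fun x hx => (Real.differentiableAt_log (ne_of_gt hx.2)).differentiableWithinAt)
      (measure_mono_null inter_subset_left h)
    refine measure_mono_null (fun t ht => ?_) himg
    exact ⟨Real.exp t, ⟨ht, Real.exp_pos t⟩, Real.log_exp t⟩
  exact (measurePreserving_sub_right
    (volume : Measure ℝ) τ₀).quasiMeasurePreserving.tendsto_ae.eventually h1

/-- Substitution x = e^{τ-s} m, under which ds becomes -dx/x. -/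
theorem integral_tail_exp {h : ℝ → ℝ} (hh : Integrable h) {m : ℝ} (hm : 1 ≤ m) (τ : ℝ) :
    ∫ s in (0 : ℝ)..τ, tail h (Real.exp (τ - s) * m) =
      ∫ x in m..Real.exp τ * m, tail h x / x := by
  rw [intervalIntegral.integral_comp_sub_left (fun u => tail h (Real.exp u * m)) τ, sub_self,
    sub_zero]
  have hpos : ∀ u : ℝ, 0 < Real.exp u * m := fun u => mul_pos (Real.exp_pos u) (by linarith)
  have key := intervalIntegral.integral_comp_mul_deriv' (a := 0) (b := τ)
    (f := fun u => Real.exp u * m) (f' := fun u => Real.exp u * m) (g := fun x => tail h x / x)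
    (fun u _ => (Real.hasDerivAt_exp u).mul_const m) (by fun_prop) (by
      refine (continuous_tail hh).continuousOn.div continuousOn_id ?_
      rintro _ ⟨u, _, rfl⟩
      exact (hpos u).ne')
  simp only [Function.comp_apply, Real.exp_zero, one_mul] at key
  rw [← key]
  refine intervalIntegral.integral_congr fun u _ => ?_
  exact (div_mul_cancel₀ _ (hpos u).ne').symm

/-- A tail is a continuous linear functional, so it passes through the Bochner integral and reduces
Duhamel's formula to scalar integrals. -/
theorem tail_duhamel (f h : L1) (β : ℝ) (τ a : ℝ) :
    tail (rescaleL1 τ f + ∫ s in (0 : ℝ)..τ, β • rescaleL1 (τ - s) h : L1) a =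
      tail f (Real.exp τ * max a 1) +
        β * ∫ x in max a 1..Real.exp τ * max a 1, tail h x / x := by
  have hc : Continuous fun s => β • rescaleL1 (τ - s) h :=
    ((continuous_rescaleL1_left h).comp (continuous_const.sub continuous_id)).const_smul β
  rw [← tailCLM_apply, map_add, ← ContinuousLinearMap.intervalIntegral_comp_comm _
    (hc.intervalIntegrable _ _), tailCLM_apply, tail_rescaleL1,
    ← integral_tail_exp (L1.integrable_coeFn h) (le_max_right a 1),
    ← intervalIntegral.integral_const_mul]
  congr 2 with s
  rw [map_smul, tailCLM_apply, tail_rescaleL1, smul_eq_mul]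

theorem coeFn_shiftL1_nonlinL1 (N : ℕ) (p : ℕ → ℝ) (f : L1) :
    shiftL1 (nonlinL1 N p f) =ᵐ[volume] shift (nonlin N p f) :=
  (Integrable.coeFn_toL1 _).trans (shift_congr (Integrable.coeFn_toL1 _))

theorem SteadyRelation.mul_eq {N : ℕ} {p : ℕ → ℝ} (hp1 : ∑ j ∈ Finset.Icc 1 N, p j = 1)
    {f : ℝ → ℝ} (hf : IsDensity f) {β : ℝ} (h : SteadyRelation N p β f) :
    ∀ᵐ y : ℝ, y ∈ Icc (1 : ℝ) 2 → y * f y = β := by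
  filter_upwards [h, Measure.ae_ne volume (1 : ℝ)] with y hy h1 hy'
  rw [hy (lt_of_le_of_ne hy'.1 h1.symm), tail_shift_nonlin_eq_one hp1 hf hy'.2, mul_one]

theorem SteadyRelation.hasValueAtOne {N : ℕ} {p : ℕ → ℝ}
    (hp1 : ∑ j ∈ Finset.Icc 1 N, p j = 1) {η₀ : L1} (hf : IsDensity η₀) {β : ℝ}
    (h : SteadyRelation N p β η₀) : HasValueAtOne η₀ β := by
  refine ⟨fun y => β / y, ?_, by simp, ?_⟩
  · exact continuousOn_const.div continuousOn_id fun x hx => by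
      exact (zero_lt_one.trans_le hx.1).ne'
  · filter_upwards [h.mul_eq hp1 hf] with y hy hy'
    rw [← hy hy', mul_div_cancel_left₀]
    have := hy'.1
    positivity

theorem exp_sub_mem_Icc {τ τ₀ : ℝ} (h : τ ∈ Icc τ₀ (τ₀ + Real.log 2)) :
    Real.exp (τ - τ₀) ∈ Icc (1 : ℝ) 2 := by
  refine ⟨Real.one_le_exp (by linarith [h.1]), ?_⟩
  rw [← Real.le_log_iff_exp_le two_pos]
  linarith [h.2]

theorem SteadyRelation.trace_eq {N : ℕ} {p : ℕ → ℝ}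
    (hp1 : ∑ j ∈ Finset.Icc 1 N, p j = 1) {f : ℝ → ℝ} (hf : IsDensity f) {β : ℝ}
    (h : SteadyRelation N p β f) (τ₀ : ℝ) :
    ∀ᵐ τ : ℝ, τ ∈ Icc τ₀ (τ₀ + Real.log 2) →
      Real.exp (τ - τ₀) * f (Real.exp (τ - τ₀)) = β := by
  filter_upwards [ae_comp_exp_sub (h.mul_eq hp1 hf) τ₀] with τ hτ hmem
  exact hτ (exp_sub_mem_Icc hmem)

/-- Equality is tested on tails: both sides become integrals over (m, e^τ m) with m = max(a,1) ≥ 1,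
whose integrands agree a.e. by the relation. -/
theorem SteadyRelation.duhamel {N : ℕ} {p : ℕ → ℝ} {η₀ : L1} (hf : IsDensity η₀) {β : ℝ}
    (h : SteadyRelation N p β η₀) {τ : ℝ} (hτ : 0 ≤ τ) :
    η₀ = rescaleL1 τ η₀ +
      ∫ s in (0 : ℝ)..τ, β • rescaleL1 (τ - s) (shiftL1 (nonlinL1 N p η₀)) := by
  refine eq_of_tail_eq fun a => ?_
  rw [tail_duhamel, ← tail_max_one hf.integrable hf.eq_zero a, tail_congr (coeFn_shiftL1_nonlinL1 N p η₀),
    ← sub_eq_iff_eq_add', tail_sub_tail hf.integrable, ← intervalIntegral.integral_const_mul]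
  refine intervalIntegral.integral_congr_ae ?_
  filter_upwards [h] with x hx hmem
  have hle : max a 1 ≤ Real.exp τ * max a 1 :=
    le_mul_of_one_le_left (by positivity) (Real.one_le_exp hτ)
  rw [uIoc_of_le hle] at hmem
  have h1 : 1 < x := lt_of_le_of_lt (le_max_right a 1) hmem.1
  rw [← mul_div_assoc, ← hx h1, mul_div_cancel_left₀]
  positivity

theorem SteadyRelation.isGlobalSolution {N : ℕ} {p : ℕ → ℝ}
    (hp1 : ∑ j ∈ Finset.Icc 1 N, p j = 1) {η₀ : L1} (hf : IsDensity η₀) {β : ℝ}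
    (h : SteadyRelation N p β η₀) : IsGlobalSolution N p η₀ fun _ => η₀ := by
  refine ⟨continuousOn_const, fun _ _ => hf.eq_zero, fun _ => β,
    (locallyIntegrable_const β).locallyIntegrableOn _, fun τ₀ _ => ?_,
    fun τ hτ => h.duhamel hf hτ⟩
  filter_upwards [h.trace_eq hp1 hf τ₀] with τ hτ hmem using (hτ hmem).symm

/-- Uniqueness of mild solutions with a given constant trace. -/
theorem eq_of_duhamel {N : ℕ} {p : ℕ → ℝ} {η₀ : L1} {β T : ℝ} {η : ℝ → L1} {b : ℝ → ℝ}
    (hη : ContinuousOn η (Ici 0))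
    (h0 : ∀ τ, 0 ≤ τ → η₀ = rescaleL1 τ η₀ +
      ∫ s in (0 : ℝ)..τ, β • rescaleL1 (τ - s) (shiftL1 (nonlinL1 N p η₀)))
    (h : ∀ τ, 0 ≤ τ → η τ = rescaleL1 τ η₀ +
      ∫ s in (0 : ℝ)..τ, b s • rescaleL1 (τ - s) (shiftL1 (nonlinL1 N p (η s))))
    (hb : ∀ᵐ s : ℝ, s ∈ Icc 0 T → b s = β) : ∀ τ ∈ Icc 0 T, η τ = η₀ := by
  have hηT : ContinuousOn η (Icc 0 T) := hη.mono Icc_subset_Ici_self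
  obtain ⟨M, hM⟩ := (isCompact_Icc.image_of_continuousOn hηT).isBounded.exists_norm_le
  -- The nonlinearity is only locally Lipschitz; this ball contains the compact path on [0,T] and
  -- the stationary state.
  obtain ⟨C, hC, hLip⟩ := exists_norm_nonlinL1_sub_le N p (max M ‖η₀‖)
  have hu : ContinuousOn (fun s => ‖η s - η₀‖) (Icc 0 T) := (hηT.sub continuousOn_const).norm
  have key := eq_zero_of_le_mul_integral (K := |β| * C) hu (fun _ _ => norm_nonneg _)
    fun t ht => by
      have hsub : Icc 0 t ⊆ Icc 0 T := Icc_subset_Icc_right ht.2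
      have hc1 : IntervalIntegrable
          (fun s => β • rescaleL1 (t - s) (shiftL1 (nonlinL1 N p (η s)))) volume 0 t := by
        refine ContinuousOn.intervalIntegrable ?_
        rw [uIcc_of_le ht.1]
        exact (continuousOn_rescaleL1_shiftL1_nonlinL1 N p (hηT.mono hsub) t).const_smul β
      have hc2 : IntervalIntegrable
          (fun s => β • rescaleL1 (t - s) (shiftL1 (nonlinL1 N p η₀))) volume 0 t :=
        ((continuousOn_rescaleL1_shiftL1_nonlinL1 N p
          (η := fun _ => η₀) continuousOn_const t).const_smul β).intervalIntegrable
      have hb' : ∫ s in (0 : ℝ)..t, b s • rescaleL1 (t - s) (shiftL1 (nonlinL1 N p (η s))) =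
          ∫ s in (0 : ℝ)..t, β • rescaleL1 (t - s) (shiftL1 (nonlinL1 N p (η s))) := by
        refine intervalIntegral.integral_congr_ae ?_
        filter_upwards [hb] with s hs hmem
        rw [uIoc_of_le ht.1] at hmem
        rw [hs (hsub (Ioc_subset_Icc_self hmem))]
      have hdiff : η t - η₀ = ∫ s in (0 : ℝ)..t,
          (β • rescaleL1 (t - s) (shiftL1 (nonlinL1 N p (η s))) -
            β • rescaleL1 (t - s) (shiftL1 (nonlinL1 N p η₀))) := by
        rw [intervalIntegral.integral_sub hc1 hc2, ← hb']
        nth_rewrite 1 [h t ht.1]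
        nth_rewrite 2 [h0 t ht.1]
        abel
      rw [hdiff, ← intervalIntegral.integral_const_mul]
      refine intervalIntegral.norm_integral_le_of_norm_le ht.1 (.of_forall fun s hs => ?_) ?_
      · have hs' : s ∈ Icc 0 T := hsub (Ioc_subset_Icc_self hs)
        rw [← smul_sub, norm_smul, Real.norm_eq_abs, mul_assoc]
        refine mul_le_mul_of_nonneg_left ?_ (abs_nonneg _)
        exact ((norm_rescaleL1_sub_le _ _ _).trans (norm_shiftL1_sub_le _ _)).trans
          (hLip _ _ ((hM _ (mem_image_of_mem _ hs')).trans (le_max_left _ _)) (le_max_right _ _))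
      · refine ContinuousOn.intervalIntegrable ?_
        rw [uIcc_of_le ht.1]
        exact continuousOn_const.mul (hu.mono hsub)
  intro τ hτ
  exact sub_eq_zero.1 (norm_eq_zero.1 (key τ hτ))

theorem ae_Icc_nat_mul_succ {P : ℝ → Prop} {L : ℝ} {n : ℕ}
    (h : ∀ᵐ τ : ℝ, τ ∈ Icc 0 (n * L) → P τ)
    (h' : ∀ᵐ τ : ℝ, τ ∈ Icc (n * L) (n * L + L) → P τ) :
    ∀ᵐ τ : ℝ, τ ∈ Icc 0 ((n + 1 : ℕ) * L) → P τ := by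
  filter_upwards [h, h'] with τ h1 h2 hτ
  rcases le_total τ (n * L) with hle | hle
  · exact h1 ⟨hτ.1, hle⟩
  · refine h2 ⟨hle, hτ.2.trans_eq ?_⟩
    push_cast
    ring

theorem ae_Icc_zero (P : ℝ → Prop) (L : ℝ) :
    ∀ᵐ τ : ℝ, τ ∈ Icc 0 ((0 : ℕ) * L) → P τ := by
  filter_upwards [Measure.ae_ne volume (0 : ℝ)] with τ hτ hmem
  simp only [Nat.cast_zero, zero_mul, Icc_self, mem_singleton_iff] at hmem
  exact absurd hmem hτ

/-- Uniqueness advances in steps of log 2: trace β up to time n log 2 forces η(n log 2) = η₀ by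
`eq_of_duhamel`, and this profile prescribes the trace on the next step, again β. -/
theorem SteadyRelation.isSteadyState {N : ℕ} {p : ℕ → ℝ}
    (hp1 : ∑ j ∈ Finset.Icc 1 N, p j = 1) {η₀ : L1} (hf : IsDensity η₀) {β : ℝ}
    (h : SteadyRelation N p β η₀) : IsSteadyState N p η₀ := by
  refine ⟨⟨_, h.isGlobalSolution hp1 hf⟩, ?_⟩
  rintro η ⟨hc, -, b, -, htrace, hduhamel⟩
  have hL : 0 < Real.log 2 := Real.log_pos one_lt_two
  have hb : ∀ n : ℕ, ∀ᵐ τ : ℝ, τ ∈ Icc 0 (n * Real.log 2) → b τ = β := by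
    intro n
    induction n with
    | zero => exact ae_Icc_zero _ _
    | succ n ih =>
      have hn : 0 ≤ n * Real.log 2 := by positivity
      refine ae_Icc_nat_mul_succ ih ?_
      have heq := eq_of_duhamel hc (fun τ hτ => h.duhamel hf hτ) hduhamel ih _ ⟨hn, le_rfl⟩
      filter_upwards [htrace _ hn, h.trace_eq hp1 hf (n * Real.log 2)] with τ h1 h2 hτ
      rw [h1 hτ, heq, h2 hτ]
  intro τ hτ
  obtain ⟨n, hn⟩ := exists_nat_ge (τ / Real.log 2)
  exact eq_of_duhamel hc (fun τ hτ => h.duhamel hf hτ) hduhamel (hb n) τ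
    ⟨hτ, (div_le_iff₀ hL).1 hn⟩

/-- The trace of a stationary solution is constant. -/
theorem ae_trace_eq {η₀ : L1} {β : ℝ} (hβ : HasValueAtOne η₀ β) {b : ℝ → ℝ}
    (hb : ∀ τ₀, 0 ≤ τ₀ → ∀ᵐ τ : ℝ, τ ∈ Icc τ₀ (τ₀ + Real.log 2) →
      b τ = Real.exp (τ - τ₀) * η₀ (Real.exp (τ - τ₀))) (n : ℕ) :
    ∀ᵐ τ : ℝ, τ ∈ Icc 0 (n * Real.log 2) → b τ = β := by
  obtain ⟨g, hg, hg1, hηg⟩ := hβ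
  have hL : 0 < Real.log 2 := Real.log_pos one_lt_two
  set G : ℝ → ℝ := fun t => Real.exp t * g (Real.exp t) with hG
  have hGc : ContinuousOn G (Icc 0 (Real.log 2)) := by
    refine Real.continuous_exp.continuousOn.mul
      (hg.comp Real.continuous_exp.continuousOn fun t ht => ?_)
    simpa using exp_sub_mem_Icc (τ := t) (τ₀ := 0) (by simpa using ht)
  have hbG : ∀ τ₀, 0 ≤ τ₀ → ∀ᵐ τ : ℝ, τ ∈ Icc τ₀ (τ₀ + Real.log 2) → b τ = G (τ - τ₀) := by
    intro τ₀ h0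
    filter_upwards [hb τ₀ h0, ae_comp_exp_sub hηg τ₀] with τ h1 h2 hτ
    rw [h1 hτ, h2 (exp_sub_mem_Icc hτ)]
  -- Reading the same trace from τ₀ = 0 and from τ₀ = δ gives G(t) = G(t - δ) a.e. on [δ, log 2]. By
  -- continuity this holds at t = δ, so G(δ) = G(0) = g(1). The right endpoint is excluded because
  -- the interval must be nondegenerate.
  have hconst : ∀ δ ∈ Ico 0 (Real.log 2), G δ = β := by
    intro δ hδ
    have hae : G =ᵐ[volume.restrict (Icc δ (Real.log 2))] fun t => G (t - δ) := by
      refine (ae_restrict_iff' measurableSet_Icc).2 ?_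
      filter_upwards [hbG 0 le_rfl, hbG δ hδ.1] with t h1 h2 ht
      have e1 := h1 ⟨hδ.1.trans ht.1, by linarith [ht.2]⟩
      rw [sub_zero] at e1
      rw [← e1, h2 ⟨ht.1, by linarith [ht.2, hδ.1]⟩]
    have := Measure.eqOn_Icc_of_ae_eq volume hδ.2.ne hae
      (hGc.mono (Icc_subset_Icc_left hδ.1))
      (hGc.comp (by fun_prop) fun t ht => ⟨by linarith [ht.1], by linarith [ht.2, hδ.1]⟩)
      (left_mem_Icc.2 hδ.2.le)
    rw [this]
    simp [hG, hg1]
  induction n with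
  | zero => exact ae_Icc_zero _ _
  | succ n ih =>
    refine ae_Icc_nat_mul_succ ih ?_
    filter_upwards [hbG (n * Real.log 2) (by positivity),
      Measure.ae_ne volume (n * Real.log 2 + Real.log 2)] with τ h1 h2 hτ
    rw [h1 hτ]
    refine hconst _ ⟨by linarith [hτ.1], ?_⟩
    linarith [lt_of_le_of_ne hτ.2 h2]

/-- The tail at 1 of Duhamel's formula at time log y gives ∫_1^y η₀ = β ∫_1^y (tail of k)(x)/x dx
for every y > 1; differentiation in y concludes. -/
theorem IsSteadyState.steadyRelation {N : ℕ} {p : ℕ → ℝ} {η₀ : L1} {β : ℝ}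
    (h : IsSteadyState N p η₀) (hβ : HasValueAtOne η₀ β) : SteadyRelation N p β η₀ := by
  obtain ⟨⟨η, hη⟩, huniq⟩ := h
  have hconst := huniq η hη
  obtain ⟨-, -, b, -, htrace, hduhamel⟩ := hη
  have hL : 0 < Real.log 2 := Real.log_pos one_lt_two
  have hb := ae_trace_eq hβ (b := b) fun τ₀ h0 => by
    have := htrace τ₀ h0
    rwa [hconst τ₀ h0] at this
  have hi := L1.integrable_coeFn η₀
  have hk := integrable_shift (integrable_nonlin N p hi)
  set k := shift (nonlin N p η₀) with hkdef
  have hfix : ∀ τ, 0 ≤ τ → η₀ = rescaleL1 τ η₀ +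
      ∫ s in (0 : ℝ)..τ, β • rescaleL1 (τ - s) (shiftL1 (nonlinL1 N p η₀)) := by
    intro τ hτ
    obtain ⟨n, hn⟩ := exists_nat_ge (τ / Real.log 2)
    have h1 := hduhamel τ hτ
    rw [hconst τ hτ] at h1
    refine h1.trans (congrArg _ (intervalIntegral.integral_congr_ae ?_))
    filter_upwards [hb n] with s hs hmem
    rw [uIoc_of_le hτ] at hmem
    rw [hs ⟨hmem.1.le, hmem.2.trans ((div_le_iff₀ hL).1 hn)⟩, hconst s hmem.1.le]
  -- `wStar` replaces 1/x to avoid the singularity at 0; the two agree on [1,∞).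
  have hq : LocallyIntegrable fun x => β * (tail k x * wStar x) := by
    refine (locallyIntegrable_const (|β| * ∫ y, |k y|)).mono
      (((continuous_tail hk).aestronglyMeasurable.mul
        measurable_wStar.aestronglyMeasurable).const_mul β) (.of_forall fun x => ?_)
    have hnn : 0 ≤ ∫ y, |k y| := integral_nonneg fun _ => abs_nonneg _
    rw [Real.norm_eq_abs, abs_mul, abs_mul, Real.norm_of_nonneg (by positivity)]
    refine mul_le_mul_of_nonneg_left ?_ (abs_nonneg β)
    calc |tail k x| * |wStar x| ≤ |tail k x| * 1 :=
          mul_le_mul_of_nonneg_left (abs_wStar_le x) (abs_nonneg _)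
      _ ≤ _ := by rw [mul_one]; exact abs_tail_le hk x
  have key := ae_eq_zero_of_intervalIntegral_eq_zero (c := 1)
    (hi.locallyIntegrable.sub hq) fun y hy => by
      have hy0 : 0 < y := by linarith
      have h1 := congrArg (fun f : L1 => tail f 1) (hfix (Real.log y) (Real.log_nonneg hy.le))
      simp only [tail_duhamel, max_self, mul_one, Real.exp_log hy0] at h1
      rw [tail_congr (coeFn_shiftL1_nonlinL1 N p η₀), ← sub_eq_iff_eq_add', tail_sub_tail hi] at h1
      simp only [Pi.sub_apply]
      rw [intervalIntegral.integral_sub hi.intervalIntegrable 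
          (hq.integrableOn_isCompact isCompact_uIcc).intervalIntegrable, h1,
        intervalIntegral.integral_const_mul, sub_eq_zero]
      congr 1
      refine intervalIntegral.integral_congr fun x hx => ?_
      rw [uIcc_of_le hy.le] at hx
      simp only [wStar_of_one_le hx.1, mul_one_div, hkdef]
  filter_upwards [key] with y hy h1
  have hy' := hy h1
  simp only [Pi.sub_apply, wStar_of_one_le h1.le] at hy'
  rw [sub_eq_zero.1 hy']
  have : y ≠ 0 := by positivity
  rw [← hkdef]
  field_simp

end Coarsening

end

theorem proposition4p3 (N : ℕ) (p : ℕ → ℝ)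
    (hp_nonneg : ∀ j ∈ Finset.Icc 1 N, 0 ≤ p j)
    (hp_sum : ∑ j ∈ Finset.Icc 1 N, p j = 1)
    (η₀ : Coarsening.L1) (hη₀ : η₀ ∈ Coarsening.probDensities)
    (β : ℝ) (hβ : 0 < β) :
    List.TFAE
      [Coarsening.IsSteadyState N p η₀ ∧ Coarsening.HasValueAtOne η₀ β,
       ∃ η : ℝ → ℝ, Coarsening.SolvesSteadyODE N p β η ∧
         ∀ᵐ y : ℝ, 1 < y → η₀ y = η y,
       ∀ᵐ y : ℝ, Coarsening.calN N p η₀ y = β * Coarsening.wStar y] := by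
  have hf := Coarsening.isDensity_of_mem hη₀
  tfae_have 1 → 2 := fun h =>
    (Coarsening.IsSteadyState.steadyRelation h.1 h.2).exists_solvesSteadyODE hp_sum hf
  tfae_have 2 → 3 := fun ⟨_, hη, hfη⟩ =>
    (hη.steadyRelation hp_sum hf hfη).calN_ae_eq hp_nonneg hp_sum hf
  tfae_have 3 → 1 := fun h =>
    have hr := Coarsening.steadyRelation_of_calN_ae_eq hp_nonneg hp_sum hf hβ h
    ⟨hr.isSteadyState hp_sum hf, hr.hasValueAtOne hp_sum hf⟩
  tfae_finish
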